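/- For $N\in\mathbb{N}$, $N\ge 1$, let $\Gamma_N$ be the star graph consisting of $N$ half-lines $[0,\infty)$ with their endpoints $0$ identified, so that $\Gamma_2=\mathbb{R}$. Let $V:\Gamma_N\to\mathbb{R}$ satisfy $V_+\in L^1_{\rm loc}(\Gamma_N)$ and $V_-\in L^p(\Gamma_N)$ for some $1\le p<\infty$. Let $H=-\frac{d^2}{dx^2}+V$ be the self-adjoint operator in $L^2(\Gamma_N)$ associated with the quadratic form $$h[\psi]=\int_{\Gamma_N}\left(|\psi'|^2+V|\psi|^2\right)dx,\qquad \psi\in H^1(\Gamma_N)\cap L^2(\Gamma_N,V_+\,dx),$$ where $\psi\in H^1(\Gamma_N)$ means that the restrictions of $\psi$ to the $N$ edges belong to $H^1(0,\infty)$ and that their values at the vertex coincide. Write $\operatorname{tr}H_-^\gamma$ for the sum of $|\lambda|^\gamma$ over the negative eigenvalues $\lambda$ of $H$, counted with multiplicity. Let $L_{\gamma,N}\in[0,\infty]$ be the smallest constant such that $$\operatorname{tr}H_-^\gamma\le L_{\gamma,N}\int_{\Gamma_N}V_-^{\gamma+1/2}\,dx$$ for all such $V$ for which the integral on the right is finite,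 and put $L_\gamma:=L_{\gamma,2}$, the optimal constant for $\Gamma_2=\mathbb{R}$. Let $\gamma\ge 1/2$. If $N_0<N$ are both odd, then $$L_{\gamma,N}\le\frac{N-N_0}{N}\,L_\gamma+\frac{N_0}{N}\,L_{\gamma,N_0}.$$ In particular, if $L_{\gamma,N_0}=L_\gamma$ for some odd $N_0\in\mathbb{N}$, then $L_{\gamma,N}=L_\gamma$ for all $N\ge N_0$ (odd or even). -/

import Mathlib

open MeasureTheory
open scoped ENNReal ComplexConjugate

noncomputable section

namespace StarGraph

/-- Lebesgue measure on the open half-line `(0, ∞)`. -/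
abbrev halfLineMeasure : Measure ℝ := volume.restrict (Set.Ioi (0 : ℝ))

/-- The complex Hilbert space `L²(0, ∞)`. -/
abbrev HalfLineL2 : Type := Lp ℂ 2 halfLineMeasure

/-- `L²(Γ)` for the star graph `Γ` whose edges, copies of the half-line `[0, ∞)` glued at `0`, are
indexed by the finite type `ι`. The graph `Γ_N` is the case `ι = Fin N`. A function on `Γ` is given
by its restrictions to the edges, and `‖ψ‖² = ∑ i, ‖ψ i‖²`. -/
abbrev StarL2 (ι : Type) [Fintype ι] : Type := PiLp 2 (fun _ : ι => HalfLineL2)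

/-- `u ∈ H¹(0, ∞)`, with (weak) derivative `u' ∈ L²(0, ∞)` and boundary value `c = u(0)`: the
class `u` has the absolutely continuous representative `x ↦ c + ∫₀ˣ u'`. -/
def HasDerivTrace (u u' : HalfLineL2) (c : ℂ) : Prop :=
  ∀ᵐ x ∂halfLineMeasure, u x = c + ∫ t in (0 : ℝ)..x, u' t

variable {ι : Type} [Fintype ι]

/-- `ψ ∈ H¹(Γ)` with derivative `ψ'`: all restrictions of `ψ` to the edges belong to `H¹(0, ∞)`,
and their values at the vertex coincide. -/
def HasStarDeriv (ψ ψ' : StarL2 ι) : Prop :=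
  ∃ c : ℂ, ∀ i, HasDerivTrace (ψ i) (ψ' i) c

/-- The standing assumptions on a potential `V : Γ → ℝ`, given by its restrictions `V i` to the
edges (only the values on `(0, ∞)` matter): the positive part is locally integrable (up to the
vertex), and the negative part is in `L^p` for some `1 ≤ p < ∞`. -/
structure IsPotential (V : ι → ℝ → ℝ) : Prop where
  posPart_loc : ∀ i, ∀ R : ℝ, IntegrableOn (fun x => (V i x)⁺) (Set.Ioc 0 R) volume
  negPart_memLp : ∃ p : ℝ≥0∞, 1 ≤ p ∧ p ≠ ∞ ∧
    ∀ i, MemLp (fun x => (V i x)⁻) p halfLineMeasure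

/-- The form domain `H¹(Γ) ∩ L²(Γ, V₊ dx)`. An element carries its derivative, which is determined
by the function. -/
structure FormDomain (V : ι → ℝ → ℝ) where
  toL2 : StarL2 ι
  deriv : StarL2 ι
  hasStarDeriv : HasStarDeriv toL2 deriv
  lintegral_posPart_lt_top :
    ∀ i, ∫⁻ x in Set.Ioi (0 : ℝ), ENNReal.ofReal ((V i x)⁺ * ‖toL2 i x‖ ^ 2) < ∞

/-- The sesquilinear form (antilinear in `φ`, linear in `ψ`)
`h[φ, ψ] = ∫_Γ (conj φ' ψ' + V conj φ ψ) dx`, whose quadratic form is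
`h[ψ] = ∫_Γ (|ψ'|² + V |ψ|²) dx`. -/
def form (V : ι → ℝ → ℝ) (φ ψ : FormDomain V) : ℂ :=
  inner ℂ φ.deriv ψ.deriv +
    ∑ i, ∫ x in Set.Ioi (0 : ℝ), (V i x : ℂ) * conj (φ.toL2 i x) * ψ.toL2 i x

/-- The graph of the self-adjoint Schrödinger operator `H = -d²/dx² + V` in `L²(Γ)` associated with
the form: `u ∈ dom H` and `H u = f` means that `u` belongs to the form domain and `h[φ, u] = ⟪φ, f⟫`
for all `φ` in the form domain. -/
def IsSchrodinger (V : ι → ℝ → ℝ) (u f : StarL2 ι) : Prop :=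
  ∃ ψ : FormDomain V, ψ.toL2 = u ∧ ∀ φ : FormDomain V, form V φ ψ = inner ℂ φ.toL2 f

/-- The eigenspace `ker (H - lam)`, written as the span of the solutions of `H u = lam u`. -/
def eigenspace (V : ι → ℝ → ℝ) (lam : ℝ) : Submodule ℂ (StarL2 ι) :=
  Submodule.span ℂ {u | IsSchrodinger V u ((lam : ℂ) • u)}

/-- The multiplicity `dim ker (H - lam)`; it is `0` unless `lam` is an eigenvalue. -/
def multiplicity (V : ι → ℝ → ℝ) (lam : ℝ) : ℕ∞ :=
  Cardinal.toENat (Module.rank ℂ (eigenspace V lam))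

/-- `tr H₋^γ`: the sum of `|lam| ^ γ` over the negative eigenvalues `lam` of `H`, counted with
multiplicity. -/
def traceNeg (γ : ℝ) (V : ι → ℝ → ℝ) : ℝ≥0∞ :=
  ∑' lam : Set.Iio (0 : ℝ),
    (multiplicity V (lam : ℝ) : ℝ≥0∞) * ENNReal.ofReal (|(lam : ℝ)| ^ γ)

/-- `∫_Γ V₋^(γ + 1/2) dx`. -/
def negIntegral (γ : ℝ) (V : ι → ℝ → ℝ) : ℝ≥0∞ :=
  ∑ i, ∫⁻ x in Set.Ioi (0 : ℝ), ENNReal.ofReal ((V i x)⁻ ^ (γ + 1 / 2))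

/-- The optimal constant `L_{γ,N}` in `tr H₋^γ ≤ L_{γ,N} ∫_{Γ_N} V₋^(γ + 1/2) dx`, the smallest
one in `[0, ∞]`. The inequality is void when its right-hand integral is infinite. -/
def optConst (γ : ℝ) (N : ℕ) : ℝ≥0∞ :=
  sInf {L : ℝ≥0∞ | ∀ V : Fin N → ℝ → ℝ, IsPotential V → negIntegral γ V ≠ ∞ →
    traceNeg γ V ≤ L * negIntegral γ V}

/-- `L_γ := L_{γ,2}`, the optimal constant for the line `ℝ = Γ_2`. -/
def lineConst (γ : ℝ) : ℝ≥0∞ := optConst γ 2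

end StarGraph

end

noncomputable section

namespace StarGraph

open Filter Topology Set

section

/-! ### Functions of class `H¹` on the half-line -/

/-! Upper bound. Split the edges of Γ_N into two groups and allow a function to take different
values at the two resulting vertices. The form domain grows and the form keeps its expression, so by
the variational principle the number of eigenvalues below any E < 0 is at most the sum of the
numbers for the two smaller stars (`count_le_count_add_count`). Integrating over the level
(`traceNeg_eq_lintegral`) turns this into a bound for traces. Grouping edges in pairs gives L_{γ,2m}
≤ L_γ. For N = N₀ + 2m the trace is thus bounded by L_{γ,N₀} times the integral over N₀ edges plus
L_γ times the integral over the others. In the average over all N cyclic rotations of the labels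
every edge falls N₀ times into the first group, which produces the weights N₀/N and (N - N₀)/N.

Lower bound L_γ ≤ L_{γ,N} (`lineConst_le_optConst`). Given a potential on the line, put the vertex
of the star at distance R from the origin: one edge carries the line up to that point, and every
other edge carries a copy of the tail beyond it. Functions are transplanted in the same way and stay
continuous at the vertex. As R → ∞ the matrix of the form of H - E on finitely many eigenfunctions
converges to the one on the line, so eigenvalue counts can only drop in the limit
(`count_le_liminf_graft`), while the extra mass of V₋ vanishes. Fatou's lemma in the level variable
concludes. Both bounds together give the equality of the constants.

The variational principle is derived from the form definition of H. On the orthogonal complement of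
finitely many eigenspaces the Rayleigh quotient, if it goes below E < 0, has a minimiser, and this
is a new eigenvector (`shiftedForm_nonneg_of_orthogonal`). The minimiser exists by
`exists_subseq_tendsto`: for λ < 0 the form of H - λ is a coercive form minus an integrable
potential, and an integrable potential is a compact perturbation. -/

theorem integrableOn_Ioc (v : HalfLineL2) {a : ℝ} (ha : 0 ≤ a) (b : ℝ) :
    IntegrableOn v (Ioc a b) volume := by
  have h : MemLp v 2 (volume.restrict (Ioc a b)) :=
    (Lp.memLp v).mono_measure
      (Measure.restrict_mono (fun x hx => lt_of_le_of_lt ha hx.1) le_rfl)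
  exact h.integrable (by norm_num)

theorem intervalIntegrable_coe (v : HalfLineL2) {a b : ℝ} (ha : 0 ≤ a) (hb : 0 ≤ b) :
    IntervalIntegrable v volume a b :=
  ⟨integrableOn_Ioc v ha b, integrableOn_Ioc v hb a⟩

/-- Cauchy–Schwarz against the indicator of (a, b]. This is the source of the Hölder-1/2 bound for
H¹ functions. -/
theorem norm_intervalIntegral_le (v : HalfLineL2) {a b : ℝ} (ha : 0 ≤ a) (hab : a ≤ b) :
    ‖∫ t in a..b, v t‖ ≤ Real.sqrt (b - a) * ‖v‖ := by
  have hs : MeasurableSet (Ioc a b) := measurableSet_Ioc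
  have hsub : Ioc a b ⊆ Ioi 0 := fun x hx => lt_of_le_of_lt ha hx.1
  have hm : halfLineMeasure (Ioc a b) = ENNReal.ofReal (b - a) := by
    rw [Measure.restrict_apply hs, inter_eq_left.2 hsub, Real.volume_Ioc]
  have hfin : halfLineMeasure (Ioc a b) ≠ ∞ := by rw [hm]; exact ENNReal.ofReal_ne_top
  have h1 := L2.inner_indicatorConstLp_one (𝕜 := ℂ) hs hfin v
  have h2 : ∫ t in a..b, v t = inner ℂ (indicatorConstLp 2 hs hfin (1 : ℂ)) v := by
    rw [h1, intervalIntegral.integral_of_le hab, Measure.restrict_restrict hs,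
      inter_eq_left.2 hsub]
  rw [h2]
  refine (norm_inner_le_norm _ _).trans (le_of_eq ?_)
  rw [norm_indicatorConstLp (by norm_num) (by norm_num), Measure.real, hm,
    ENNReal.toReal_ofReal (by linarith), Real.sqrt_eq_rpow]
  norm_num

/-- The absolutely continuous function with value `c` at `0` and derivative `v`. -/
def rep (c : ℂ) (v : HalfLineL2) (x : ℝ) : ℂ := c + ∫ t in (0 : ℝ)..x, v t

theorem rep_sub_rep (c : ℂ) (v : HalfLineL2) {x y : ℝ} (hx : 0 ≤ x) (hy : 0 ≤ y) :
    rep c v y - rep c v x = ∫ t in x..y, v t := by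
  rw [← intervalIntegral.integral_interval_sub_left (intervalIntegrable_coe v le_rfl hy)
    (intervalIntegrable_coe v le_rfl hx)]
  simp [rep]

theorem norm_rep_sub_rep_le (c : ℂ) (v : HalfLineL2) {x y : ℝ} (hx : 0 ≤ x) (hxy : x ≤ y) :
    ‖rep c v y - rep c v x‖ ≤ Real.sqrt (y - x) * ‖v‖ := by
  rw [rep_sub_rep c v hx (hx.trans hxy)]
  exact norm_intervalIntegral_le v hx hxy

theorem intervalIntegral_coe_add (v w : HalfLineL2) {a b : ℝ} (ha : 0 ≤ a) (hab : a ≤ b) :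
    ∫ t in a..b, (v + w : HalfLineL2) t = (∫ t in a..b, v t) + ∫ t in a..b, w t := by
  rw [← intervalIntegral.integral_add (intervalIntegrable_coe v ha (ha.trans hab))
    (intervalIntegrable_coe w ha (ha.trans hab))]
  refine intervalIntegral.integral_congr_ae ?_
  have h := (ae_restrict_iff' measurableSet_Ioi).1 (Lp.coeFn_add v w)
  filter_upwards [h] with t ht hmem
  rw [uIoc_of_le hab] at hmem
  exact ht (lt_of_le_of_lt ha hmem.1)

theorem intervalIntegral_coe_smul (k : ℂ) (v : HalfLineL2) {a b : ℝ} (ha : 0 ≤ a) (hab : a ≤ b) :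
    ∫ t in a..b, (k • v : HalfLineL2) t = k * ∫ t in a..b, v t := by
  rw [← intervalIntegral.integral_const_mul]
  refine intervalIntegral.integral_congr_ae ?_
  have h := (ae_restrict_iff' measurableSet_Ioi).1 (Lp.coeFn_smul k v)
  filter_upwards [h] with t ht hmem
  rw [uIoc_of_le hab] at hmem
  exact ht (lt_of_le_of_lt ha hmem.1)

theorem rep_add (c d : ℂ) (v w : HalfLineL2) {x : ℝ} (hx : 0 ≤ x) :
    rep (c + d) (v + w) x = rep c v x + rep d w x := by
  rw [rep, intervalIntegral_coe_add v w le_rfl hx, rep, rep]; ring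

theorem rep_smul (k c : ℂ) (v : HalfLineL2) {x : ℝ} (hx : 0 ≤ x) :
    rep (k * c) (k • v) x = k * rep c v x := by
  rw [rep, intervalIntegral_coe_smul k v le_rfl hx, rep]; ring

theorem rep_sub (c d : ℂ) (v w : HalfLineL2) {x : ℝ} (hx : 0 ≤ x) :
    rep (c - d) (v - w) x = rep c v x - rep d w x := by
  have h := rep_add c (-1 * d) v ((-1 : ℂ) • w) hx
  rw [rep_smul _ _ _ hx] at h
  rw [sub_eq_add_neg, sub_eq_add_neg v w, ← neg_one_smul ℂ w, neg_eq_neg_one_mul d, h]; ring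

theorem HasDerivTrace.add {u u' v v' : HalfLineL2} {c d : ℂ} (h : HasDerivTrace u u' c)
    (h' : HasDerivTrace v v' d) : HasDerivTrace (u + v) (u' + v') (c + d) := by
  filter_upwards [h, h', Lp.coeFn_add u v, ae_restrict_mem measurableSet_Ioi] with x h1 h2 h3 hx
  rw [h3, Pi.add_apply, h1, h2]
  exact (rep_add c d u' v' (le_of_lt hx)).symm

theorem HasDerivTrace.smul {u u' : HalfLineL2} {c : ℂ} (k : ℂ) (h : HasDerivTrace u u' c) :
    HasDerivTrace (k • u) (k • u') (k * c) := by
  filter_upwards [h, Lp.coeFn_smul k u, ae_restrict_mem measurableSet_Ioi] with x h1 h3 hx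
  rw [h3, Pi.smul_apply, h1]
  exact (rep_smul k c u' (le_of_lt hx)).symm

theorem hasDerivTrace_zero : HasDerivTrace 0 0 0 := by
  filter_upwards [Lp.coeFn_zero ℂ 2 halfLineMeasure, ae_restrict_mem measurableSet_Ioi]
    with x h1 hx
  have h := rep_smul 0 0 0 (le_of_lt hx)
  simp only [smul_zero, mul_zero, zero_mul] at h
  rw [h1]; exact h.symm

theorem integrable_norm_sq (u : HalfLineL2) : Integrable (fun x => ‖u x‖ ^ 2) halfLineMeasure := by
  have := (Lp.memLp u).integrable_norm_rpow (by norm_num) (by norm_num)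
  simpa using this

theorem norm_sq_eq_integral (u : HalfLineL2) : ‖u‖ ^ 2 = ∫ x, ‖u x‖ ^ 2 ∂halfLineMeasure := by
  have h := inner_self_eq_norm_sq_to_K (𝕜 := ℂ) u
  rw [L2.inner_def] at h
  have h2 : ∀ x, inner ℂ (u x) (u x) = ((‖u x‖ ^ 2 : ℝ) : ℂ) := by
    intro x; rw [inner_self_eq_norm_sq_to_K]; norm_cast
  simp_rw [h2] at h
  rw [integral_complex_ofReal] at h
  exact Complex.ofReal_injective (by rw [h]; push_cast; rfl)

/-- Average over y in (x, x + δ] the inequality |f(x)|² ≤ 2|f(y)|² + 2δ‖f'‖². Keeping δ free allows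
the derivative term to be made small relative to the kinetic energy. -/
theorem delta_mul_norm_rep_sq_le {u u' : HalfLineL2} {c : ℂ} (h : HasDerivTrace u u' c)
    {x δ : ℝ} (hx : 0 ≤ x) (hδ : 0 < δ) :
    δ * ‖rep c u' x‖ ^ 2 ≤ 2 * ‖u‖ ^ 2 + 2 * δ ^ 2 * ‖u'‖ ^ 2 := by
  have hsub : Ioc x (x + δ) ⊆ Ioi 0 := fun y hy => lt_of_le_of_lt hx hy.1
  have hint : IntegrableOn (fun y => ‖u y‖ ^ 2) (Ioc x (x + δ)) volume := by
    have := integrable_norm_sq u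
    exact IntegrableOn.mono_set this hsub
  have h1 : ∫ y in Ioc x (x + δ), ‖u y‖ ^ 2 ≤ ‖u‖ ^ 2 := by
    rw [norm_sq_eq_integral]
    exact setIntegral_mono_set (integrable_norm_sq u) (Eventually.of_forall fun _ => by positivity)
      (Eventually.of_forall hsub)
  have h2 : ∫ y in Ioc x (x + δ), ‖rep c u' x‖ ^ 2 ≤
      ∫ y in Ioc x (x + δ), (2 * ‖u y‖ ^ 2 + 2 * δ * ‖u'‖ ^ 2) := by
    refine setIntegral_mono_on_ae ?_ ?_ measurableSet_Ioc ?_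
    · exact integrableOn_const (by simp)
    · exact (hint.const_mul 2).add (integrableOn_const (by simp))
    · filter_upwards [(ae_restrict_iff' measurableSet_Ioi).1 h] with y hy hmem
      have hy' : u y = rep c u' y := hy (hsub hmem)
      rw [hy']
      have h3 := norm_rep_sub_rep_le c u' hx hmem.1.le
      have h4 : ‖rep c u' x‖ ≤ ‖rep c u' y‖ + Real.sqrt δ * ‖u'‖ := by
        have h5 : Real.sqrt (y - x) ≤ Real.sqrt δ := Real.sqrt_le_sqrt (by linarith [hmem.2])
        have h6 : ‖rep c u' x‖ ≤ ‖rep c u' y‖ + ‖rep c u' y - rep c u' x‖ := by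
          have := norm_sub_le (rep c u' y) (rep c u' y - rep c u' x)
          simpa using this
        nlinarith [norm_nonneg u']
      have h7 : (Real.sqrt δ * ‖u'‖) ^ 2 = δ * ‖u'‖ ^ 2 := by
        rw [mul_pow, Real.sq_sqrt hδ.le]
      have h8 : 0 ≤ Real.sqrt δ * ‖u'‖ := by positivity
      nlinarith [norm_nonneg (rep c u' x), norm_nonneg (rep c u' y),
        sq_nonneg (‖rep c u' y‖ - Real.sqrt δ * ‖u'‖)]
  rw [integral_add (hint.const_mul 2) (integrableOn_const (by simp)), integral_const_mul] at h2
  simp only [integral_const, smul_eq_mul, measureReal_restrict_apply_univ, Real.volume_real_Ioc,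
    add_sub_cancel_left, max_eq_left hδ.le] at h2
  nlinarith

theorem norm_rep_sq_le {u u' : HalfLineL2} {c : ℂ} (h : HasDerivTrace u u' c) {x : ℝ}
    (hx : 0 ≤ x) : ‖rep c u' x‖ ^ 2 ≤ 2 * ‖u‖ ^ 2 + 2 * ‖u'‖ ^ 2 := by
  simpa using delta_mul_norm_rep_sq_le h hx one_pos

end

section

/-! ### The form domain and the sesquilinear form -/

theorem IsPotential.aestronglyMeasurable {ι : Type} {V : ι → ℝ → ℝ} (hV : IsPotential V) (i : ι) :
    AEStronglyMeasurable (V i) halfLineMeasure := by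
  have h1 : AEStronglyMeasurable (fun x => (V i x)⁺) halfLineMeasure := by
    have : Ioi (0 : ℝ) = ⋃ n : ℕ, Ioc (0 : ℝ) n := by
      ext x
      simp only [mem_Ioi, mem_iUnion, mem_Ioc]
      refine ⟨fun h => ?_, fun ⟨_, h⟩ => h.1⟩
      obtain ⟨n, hn⟩ := exists_nat_ge x
      exact ⟨n, h, hn⟩
    rw [halfLineMeasure, this, aestronglyMeasurable_iUnion_iff]
    exact fun n => (hV.posPart_loc i n).aestronglyMeasurable
  obtain ⟨p, -, -, h2⟩ := hV.negPart_memLp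
  have h3 : V i = (fun x => (V i x)⁺) - fun x => (V i x)⁻ := by
    ext x; exact (posPart_sub_negPart _).symm
  rw [h3]
  exact h1.sub (h2 i).aestronglyMeasurable

theorem IsPotential.aestronglyMeasurable_posPart {ι : Type} {V : ι → ℝ → ℝ} (hV : IsPotential V)
    (i : ι) : AEStronglyMeasurable (fun x => (V i x)⁺) halfLineMeasure :=
  ((hV.aestronglyMeasurable i).aemeasurable.max aemeasurable_const).aestronglyMeasurable

/-- Since p < ∞, the set where V₋ ≥ ε has finite measure, and there L^p embeds in L¹. Off this set
the truncation vanishes. -/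
theorem IsPotential.integrable_truncation {ι : Type} {V : ι → ℝ → ℝ} (hV : IsPotential V) (i : ι)
    {ε : ℝ} (hε : 0 < ε) : Integrable (fun x => max ((V i x)⁻ - ε) 0) halfLineMeasure := by
  obtain ⟨p, hp1, hp, h2⟩ := hV.negPart_memLp
  have hfin := (h2 i).meas_ge_lt_top (ε := ε.toNNReal) (by positivity) hp
    (by simpa using hε)
  -- V₋ is only a.e. measurable, so the superlevel set is replaced by a measurable hull of equal
  -- measure.
  set s := toMeasurable halfLineMeasure {x | ε.toNNReal ≤ ‖(V i x)⁻‖₊} with hs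
  rw [← measure_toMeasurable] at hfin
  have h3 : IntegrableOn (fun x => (V i x)⁻) s halfLineMeasure := by
    have : IsFiniteMeasure (halfLineMeasure.restrict s) := ⟨by
      rw [Measure.restrict_apply_univ]; exact hfin⟩
    exact MemLp.integrable hp1 ((h2 i).restrict s)
  have h4 : Integrable (s.indicator fun x => (V i x)⁻) halfLineMeasure :=
    (integrable_indicator_iff (measurableSet_toMeasurable _ _)).2 h3
  refine h4.mono' ?_ (Eventually.of_forall fun x => ?_)
  · exact ((((h2 i).aestronglyMeasurable).aemeasurable.sub_const ε).max
      aemeasurable_const).aestronglyMeasurable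
  · rw [Real.norm_of_nonneg (le_max_right _ _)]
    by_cases hx : x ∈ s
    · rw [indicator_of_mem hx]
      exact max_le (by linarith) (negPart_nonneg _)
    · rw [indicator_of_notMem hx]
      refine max_le ?_ le_rfl
      have h5 : ¬ ε.toNNReal ≤ ‖(V i x)⁻‖₊ := fun h => hx (subset_toMeasurable _ _ h)
      rw [not_le, ← NNReal.coe_lt_coe, coe_nnnorm, Real.norm_of_nonneg (negPart_nonneg _),
        Real.coe_toNNReal _ hε.le] at h5
      linarith

theorem aestronglyMeasurable_coe (u : HalfLineL2) : AEStronglyMeasurable u halfLineMeasure :=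
  (Lp.memLp u).aestronglyMeasurable

theorem ae_norm_sq_le {u u' : HalfLineL2} {c : ℂ} (h : HasDerivTrace u u' c) :
    ∀ᵐ x ∂halfLineMeasure, ‖u x‖ ^ 2 ≤ 2 * ‖u‖ ^ 2 + 2 * ‖u'‖ ^ 2 := by
  filter_upwards [h, ae_restrict_mem measurableSet_Ioi] with x h1 hx
  have : u x = rep c u' x := h1
  rw [this]
  exact norm_rep_sq_le h (le_of_lt hx)

theorem integrable_mul_norm_sq {w : ℝ → ℝ} (hw : Integrable w halfLineMeasure)
    {u u' : HalfLineL2} {c : ℂ} (h : HasDerivTrace u u' c) :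
    Integrable (fun x => w x * ‖u x‖ ^ 2) halfLineMeasure := by
  refine (hw.norm.const_mul (2 * ‖u‖ ^ 2 + 2 * ‖u'‖ ^ 2)).mono' ?_ ?_
  · exact hw.aestronglyMeasurable.mul ((aestronglyMeasurable_coe u).norm.pow 2)
  · filter_upwards [ae_norm_sq_le h] with x hx
    rw [norm_mul, norm_pow, norm_norm, mul_comm]
    exact mul_le_mul_of_nonneg_right hx (norm_nonneg _)

theorem norm_add_sq_le_two_mul (a b : ℂ) : ‖a + b‖ ^ 2 ≤ 2 * ‖a‖ ^ 2 + 2 * ‖b‖ ^ 2 := by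
  nlinarith [norm_add_le a b, norm_nonneg (a + b), sq_nonneg (‖a‖ - ‖b‖)]

variable {ι : Type} [Fintype ι] {V : ι → ℝ → ℝ}

/-- The form domain as a space of pairs `(ψ, ψ')`. -/
def domain (hV : IsPotential V) : Submodule ℂ (StarL2 ι × StarL2 ι) where
  carrier := {p | HasStarDeriv p.1 p.2 ∧
    ∀ i, Integrable (fun x => (V i x)⁺ * ‖p.1 i x‖ ^ 2) halfLineMeasure}
  add_mem' := by
    rintro p q ⟨⟨c, hc⟩, hp⟩ ⟨⟨d, hd⟩, hq⟩
    refine ⟨⟨c + d, fun i => (hc i).add (hd i)⟩, fun i => ?_⟩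
    refine (((hp i).const_mul 2).add ((hq i).const_mul 2)).mono' ?_ ?_
    · exact (hV.aestronglyMeasurable_posPart i).mul ((aestronglyMeasurable_coe _).norm.pow 2)
    · filter_upwards [Lp.coeFn_add (p.1 i) (q.1 i)] with x hx
      have h1 : (p + q).1 i x = p.1 i x + q.1 i x := hx
      have hpos := posPart_nonneg (V i x)
      rw [h1, Real.norm_of_nonneg (by positivity)]
      have h3 := norm_add_sq_le_two_mul (p.1 i x) (q.1 i x)
      simp only [Pi.add_apply]
      nlinarith
  zero_mem' := by
    refine ⟨⟨0, fun i => hasDerivTrace_zero⟩, fun i => ?_⟩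
    refine (integrable_zero ℝ ℝ halfLineMeasure).congr ?_
    filter_upwards [Lp.coeFn_zero ℂ 2 halfLineMeasure] with x hx
    have h1 : (0 : StarL2 ι × StarL2 ι).1 i x = 0 := hx
    rw [h1]; simp
  smul_mem' := by
    rintro k p ⟨⟨c, hc⟩, hp⟩
    refine ⟨⟨k * c, fun i => (hc i).smul k⟩, fun i => ?_⟩
    refine ((hp i).const_mul (‖k‖ ^ 2)).congr ?_
    filter_upwards [Lp.coeFn_smul k (p.1 i)] with x hx
    have h1 : (k • p).1 i x = k * p.1 i x := hx
    rw [h1, norm_mul]; ring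

theorem mem_domain {hV : IsPotential V} {p : StarL2 ι × StarL2 ι} :
    p ∈ domain hV ↔ HasStarDeriv p.1 p.2 ∧
      ∀ i, Integrable (fun x => (V i x)⁺ * ‖p.1 i x‖ ^ 2) halfLineMeasure := Iff.rfl

theorem FormDomain.mem_domain (hV : IsPotential V) (ψ : FormDomain V) :
    (ψ.toL2, ψ.deriv) ∈ domain hV := by
  refine ⟨ψ.hasStarDeriv, fun i => ⟨?_, ?_⟩⟩
  · exact (hV.aestronglyMeasurable_posPart i).mul ((aestronglyMeasurable_coe _).norm.pow 2)
  · rw [hasFiniteIntegral_iff_ofReal (Eventually.of_forall fun x =>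
      mul_nonneg (posPart_nonneg _) (sq_nonneg _))]
    exact ψ.lintegral_posPart_lt_top i

/-- The element of the form domain given by a pair `(ψ, ψ')`. -/
def toFormDomain {hV : IsPotential V} (p : domain hV) : FormDomain V where
  toL2 := p.1.1
  deriv := p.1.2
  hasStarDeriv := p.2.1
  lintegral_posPart_lt_top i := by
    rw [← hasFiniteIntegral_iff_ofReal (Eventually.of_forall fun x =>
      mul_nonneg (posPart_nonneg _) (sq_nonneg _))]
    exact (p.2.2 i).2

theorem integrable_abs_mul_norm_sq {hV : IsPotential V} (p : domain hV) (i : ι) :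
    Integrable (fun x => |V i x| * ‖p.1.1 i x‖ ^ 2) halfLineMeasure := by
  obtain ⟨c, hc⟩ := p.2.1
  have h1 := integrable_mul_norm_sq (hV.integrable_truncation i one_pos) (hc i)
  -- Pointwise |V| ≤ V₊ + (V₋ - 1)₊ + 1, and each of the three terms is integrable against |ψ|².
  refine (((p.2.2 i).add h1).add (integrable_norm_sq (p.1.1 i))).mono' ?_ ?_
  · exact (hV.aestronglyMeasurable i).norm.mul ((aestronglyMeasurable_coe _).norm.pow 2)
  · refine Eventually.of_forall fun x => ?_
    rw [Real.norm_of_nonneg (by positivity), ← posPart_add_negPart]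
    have h2 := le_max_left ((V i x)⁻ - 1) 0
    have h3 := sq_nonneg ‖p.1.1 i x‖
    simp only [Pi.add_apply]
    nlinarith

theorem integrable_potential_mul {hV : IsPotential V} (p q : domain hV) (i : ι) :
    Integrable (fun x => (V i x : ℂ) * conj (p.1.1 i x) * q.1.1 i x) halfLineMeasure := by
  refine ((integrable_abs_mul_norm_sq p i).add (integrable_abs_mul_norm_sq q i)).mono' ?_ ?_
  · exact ((Complex.continuous_ofReal.comp_aestronglyMeasurable (hV.aestronglyMeasurable i)).mul
      (Complex.continuous_conj.comp_aestronglyMeasurable (aestronglyMeasurable_coe _))).mul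
      (aestronglyMeasurable_coe _)
  · refine Eventually.of_forall fun x => ?_
    rw [norm_mul, norm_mul, Complex.norm_real, RCLike.norm_conj, Real.norm_eq_abs]
    simp only [Pi.add_apply]
    nlinarith [abs_nonneg (V i x), two_mul_le_add_sq ‖p.1.1 i x‖ ‖q.1.1 i x‖,
      mul_nonneg (abs_nonneg (V i x)) (sq_nonneg (‖p.1.1 i x‖ - ‖q.1.1 i x‖)),
      mul_nonneg (abs_nonneg (V i x)) (mul_nonneg (norm_nonneg (p.1.1 i x))
        (norm_nonneg (q.1.1 i x)))]

/-- The sesquilinear form on the form domain. -/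
def sesqForm (hV : IsPotential V) : domain hV →ₗ⋆[ℂ] domain hV →ₗ[ℂ] ℂ :=
  LinearMap.mk₂'ₛₗ (starRingEnd ℂ) (RingHom.id ℂ)
    (fun p q => form V (toFormDomain p) (toFormDomain q))
    (by
      intro p₁ p₂ q
      have h1 : inner ℂ (p₁ + p₂).1.2 q.1.2 = inner ℂ p₁.1.2 q.1.2 + inner ℂ p₂.1.2 q.1.2 :=
        inner_add_left _ _ _
      have h2 : ∀ i, ∫ x in Set.Ioi (0 : ℝ), (V i x : ℂ) * conj ((p₁ + p₂).1.1 i x) * q.1.1 i x =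
          (∫ x in Set.Ioi (0 : ℝ), (V i x : ℂ) * conj (p₁.1.1 i x) * q.1.1 i x) +
          ∫ x in Set.Ioi (0 : ℝ), (V i x : ℂ) * conj (p₂.1.1 i x) * q.1.1 i x := by
        intro i
        rw [← integral_add (integrable_potential_mul p₁ q i) (integrable_potential_mul p₂ q i)]
        refine integral_congr_ae ?_
        filter_upwards [Lp.coeFn_add (p₁.1.1 i) (p₂.1.1 i)] with x hx
        have h3 : (p₁ + p₂).1.1 i x = p₁.1.1 i x + p₂.1.1 i x := hx
        rw [h3, map_add]; ring
      simp only [form, toFormDomain, h1, h2, Finset.sum_add_distrib]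
      ring)
    (by
      intro k p q
      have h1 : inner ℂ (k • p).1.2 q.1.2 = conj k * inner ℂ p.1.2 q.1.2 :=
        inner_smul_left _ _ _
      have h2 : ∀ i, ∫ x in Set.Ioi (0 : ℝ), (V i x : ℂ) * conj ((k • p).1.1 i x) * q.1.1 i x =
          conj k * ∫ x in Set.Ioi (0 : ℝ), (V i x : ℂ) * conj (p.1.1 i x) * q.1.1 i x := by
        intro i
        rw [← integral_const_mul]
        refine integral_congr_ae ?_
        filter_upwards [Lp.coeFn_smul k (p.1.1 i)] with x hx
        have h3 : (k • p).1.1 i x = k * p.1.1 i x := hx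
        rw [h3, map_mul]; ring
      simp only [form, toFormDomain, h1, h2, smul_eq_mul, ← Finset.mul_sum]
      ring)
    (by
      intro q p₁ p₂
      have h1 : inner ℂ q.1.2 (p₁ + p₂).1.2 = inner ℂ q.1.2 p₁.1.2 + inner ℂ q.1.2 p₂.1.2 :=
        inner_add_right _ _ _
      have h2 : ∀ i, ∫ x in Set.Ioi (0 : ℝ), (V i x : ℂ) * conj (q.1.1 i x) * (p₁ + p₂).1.1 i x =
          (∫ x in Set.Ioi (0 : ℝ), (V i x : ℂ) * conj (q.1.1 i x) * p₁.1.1 i x) +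
          ∫ x in Set.Ioi (0 : ℝ), (V i x : ℂ) * conj (q.1.1 i x) * p₂.1.1 i x := by
        intro i
        rw [← integral_add (integrable_potential_mul q p₁ i) (integrable_potential_mul q p₂ i)]
        refine integral_congr_ae ?_
        filter_upwards [Lp.coeFn_add (p₁.1.1 i) (p₂.1.1 i)] with x hx
        have h3 : (p₁ + p₂).1.1 i x = p₁.1.1 i x + p₂.1.1 i x := hx
        rw [h3]; ring
      simp only [form, toFormDomain, h1, h2, Finset.sum_add_distrib]
      ring)
    (by
      intro k q p
      have h1 : inner ℂ q.1.2 (k • p).1.2 = k * inner ℂ q.1.2 p.1.2 :=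
        inner_smul_right _ _ _
      have h2 : ∀ i, ∫ x in Set.Ioi (0 : ℝ), (V i x : ℂ) * conj (q.1.1 i x) * (k • p).1.1 i x =
          k * ∫ x in Set.Ioi (0 : ℝ), (V i x : ℂ) * conj (q.1.1 i x) * p.1.1 i x := by
        intro i
        rw [← integral_const_mul]
        refine integral_congr_ae ?_
        filter_upwards [Lp.coeFn_smul k (p.1.1 i)] with x hx
        have h3 : (k • p).1.1 i x = k * p.1.1 i x := hx
        rw [h3]; ring
      simp only [form, toFormDomain, h1, h2, smul_eq_mul, ← Finset.mul_sum, RingHom.id_apply]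
      ring)

theorem sesqForm_apply {hV : IsPotential V} (p q : domain hV) :
    sesqForm hV p q = inner ℂ p.1.2 q.1.2 +
      ∑ i, ∫ x in Set.Ioi (0 : ℝ), (V i x : ℂ) * conj (p.1.1 i x) * q.1.1 i x := rfl

theorem conj_sesqForm {hV : IsPotential V} (p q : domain hV) :
    conj (sesqForm hV p q) = sesqForm hV q p := by
  rw [sesqForm_apply, sesqForm_apply, map_add, map_sum, inner_conj_symm]
  congr 1
  refine Finset.sum_congr rfl fun i _ => ?_
  rw [← integral_conj]
  refine integral_congr_ae (Eventually.of_forall fun x => ?_)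
  simp only [map_mul, Complex.conj_ofReal, Complex.conj_conj]
  ring

theorem re_sesqForm_self {hV : IsPotential V} (p : domain hV) :
    (sesqForm hV p p).re = ‖p.1.2‖ ^ 2 + ∑ i, ∫ x in Set.Ioi (0 : ℝ), V i x * ‖p.1.1 i x‖ ^ 2 := by
  rw [sesqForm_apply, inner_self_eq_norm_sq_to_K]
  have h : ∀ i, ∫ x in Set.Ioi (0 : ℝ), (V i x : ℂ) * conj (p.1.1 i x) * p.1.1 i x =
      ((∫ x in Set.Ioi (0 : ℝ), V i x * ‖p.1.1 i x‖ ^ 2 : ℝ) : ℂ) := by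
    intro i
    rw [← integral_complex_ofReal]
    refine integral_congr_ae (Eventually.of_forall fun x => ?_)
    simp only [mul_assoc, Complex.conj_mul']
    push_cast; ring
  simp only [h]
  norm_cast

/-- The embedding of the form domain into `L²`. -/
def embed (hV : IsPotential V) : domain hV →ₗ[ℂ] StarL2 ι :=
  (LinearMap.fst ℂ (StarL2 ι) (StarL2 ι)).comp (domain hV).subtype

theorem embed_apply {hV : IsPotential V} (p : domain hV) : embed hV p = p.1.1 := rfl

theorem isSchrodinger_iff (hV : IsPotential V) {u f : StarL2 ι} :
    IsSchrodinger V u f ↔ ∃ p : domain hV, embed hV p = u ∧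
      ∀ q, sesqForm hV q p = inner ℂ (embed hV q) f := by
  constructor
  · rintro ⟨ψ, rfl, h⟩
    exact ⟨⟨_, ψ.mem_domain hV⟩, rfl, fun q => h (toFormDomain q)⟩
  · rintro ⟨p, rfl, h⟩
    exact ⟨toFormDomain p, rfl, fun φ => h ⟨_, φ.mem_domain hV⟩⟩

theorem IsSchrodinger.add (hV : IsPotential V) {u v f g : StarL2 ι} (h : IsSchrodinger V u f)
    (h' : IsSchrodinger V v g) : IsSchrodinger V (u + v) (f + g) := by
  rw [isSchrodinger_iff hV] at *
  obtain ⟨p, rfl, hp⟩ := h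
  obtain ⟨q, rfl, hq⟩ := h'
  exact ⟨p + q, map_add _ _ _, fun r => by rw [map_add, hp, hq, inner_add_right]⟩

theorem IsSchrodinger.smul (hV : IsPotential V) {u f : StarL2 ι} (k : ℂ)
    (h : IsSchrodinger V u f) : IsSchrodinger V (k • u) (k • f) := by
  rw [isSchrodinger_iff hV] at *
  obtain ⟨p, rfl, hp⟩ := h
  exact ⟨k • p, map_smul _ _ _, fun r => by rw [map_smul, hp, inner_smul_right, smul_eq_mul]⟩

theorem isSchrodinger_zero (hV : IsPotential V) : IsSchrodinger V 0 0 :=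
  (isSchrodinger_iff hV).2 ⟨0, map_zero _, fun r => by simp⟩

theorem mem_eigenspace (hV : IsPotential V) {lam : ℝ} {u : StarL2 ι} :
    u ∈ eigenspace V lam ↔ IsSchrodinger V u ((lam : ℂ) • u) := by
  refine ⟨fun h => ?_, fun h => Submodule.subset_span h⟩
  induction h using Submodule.span_induction with
  | mem x h => exact h
  | zero => rw [smul_zero]; exact isSchrodinger_zero hV
  | add x y _ _ hx hy => rw [smul_add]; exact hx.add hV hy
  | smul a x _ hx => rw [smul_comm]; exact hx.smul hV a

/-- Lower bound of the form, in terms of the `H¹` norm. -/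
theorem exists_half_norm_deriv_sq_le (hV : IsPotential V) :
    ∃ C : ℝ, 0 ≤ C ∧ ∀ p : domain hV,
      1 / 2 * ‖p.1.2‖ ^ 2 ≤ (sesqForm hV p p).re + C * ‖embed hV p‖ ^ 2 := by
  set W : ι → ℝ → ℝ := fun i x => max ((V i x)⁻ - 1) 0 with hWdef
  have hW : ∀ i, Integrable (W i) halfLineMeasure := fun i => hV.integrable_truncation i one_pos
  set A : ℝ := ∑ i, ∫ x in Ioi (0 : ℝ), W i x with hA
  have hWnn : ∀ i x, 0 ≤ W i x := fun i x => le_max_right _ _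
  have hint : ∀ i, 0 ≤ ∫ x in Ioi (0 : ℝ), W i x := fun i => integral_nonneg (hWnn i)
  have hA0 : 0 ≤ A := Finset.sum_nonneg fun i _ => hint i
  have hAi : ∀ i, ∫ x in Ioi (0 : ℝ), W i x ≤ A := fun i =>
    Finset.single_le_sum (f := fun i => ∫ x in Ioi (0 : ℝ), W i x) (fun i _ => hint i)
      (Finset.mem_univ i)
  -- Chosen so that 2δA ≤ 1/2: the truncated negative part then absorbs at most half of ‖ψ'‖².
  set δ : ℝ := 1 / (4 * (A + 1)) with hδ
  have hδ0 : 0 < δ := by positivity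
  refine ⟨1 + A * (2 / δ), by positivity, fun p => ?_⟩
  obtain ⟨c, hc⟩ := p.2.1
  have hedge : ∀ i, - (∫ x in Ioi (0 : ℝ), V i x * ‖p.1.1 i x‖ ^ 2) ≤
      ‖p.1.1 i‖ ^ 2 + A * (2 / δ * ‖p.1.1 i‖ ^ 2 + 2 * δ * ‖p.1.2 i‖ ^ 2) := by
    intro i
    have hpt : ∀ x, - (V i x * ‖p.1.1 i x‖ ^ 2) ≤ ‖p.1.1 i x‖ ^ 2 + W i x * ‖p.1.1 i x‖ ^ 2 := by
      intro x
      have h1 := le_max_left ((V i x)⁻ - 1) 0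
      have h2 := neg_le_negPart (V i x)
      have h3 : -V i x ≤ 1 + W i x := by simp only [hWdef]; linarith
      nlinarith [sq_nonneg ‖p.1.1 i x‖]
    have hVint : Integrable (fun x => V i x * ‖p.1.1 i x‖ ^ 2) halfLineMeasure := by
      refine (integrable_abs_mul_norm_sq p i).mono' ?_ (Eventually.of_forall fun x => ?_)
      · exact (hV.aestronglyMeasurable i).mul ((aestronglyMeasurable_coe _).norm.pow 2)
      · rw [norm_mul, norm_pow, norm_norm, Real.norm_eq_abs]
    have hWint := integrable_mul_norm_sq (hW i) (hc i)
    have hsup : ∀ᵐ x ∂halfLineMeasure, W i x * ‖p.1.1 i x‖ ^ 2 ≤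
        W i x * (2 / δ * ‖p.1.1 i‖ ^ 2 + 2 * δ * ‖p.1.2 i‖ ^ 2) := by
      filter_upwards [hc i, ae_restrict_mem measurableSet_Ioi] with x h1 hx
      refine mul_le_mul_of_nonneg_left ?_ (hWnn i x)
      have h4 : p.1.1 i x = rep c (p.1.2 i) x := h1
      have h5 := delta_mul_norm_rep_sq_le (hc i) (le_of_lt hx) hδ0
      rw [h4]
      have h6 : 2 / δ * ‖p.1.1 i‖ ^ 2 + 2 * δ * ‖p.1.2 i‖ ^ 2 =
          (2 * ‖p.1.1 i‖ ^ 2 + 2 * δ ^ 2 * ‖p.1.2 i‖ ^ 2) / δ := by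
        field_simp
      rw [h6, le_div_iff₀ hδ0]
      linarith
    calc - (∫ x in Ioi (0 : ℝ), V i x * ‖p.1.1 i x‖ ^ 2)
        = ∫ x in Ioi (0 : ℝ), - (V i x * ‖p.1.1 i x‖ ^ 2) := (integral_neg _).symm
      _ ≤ ∫ x in Ioi (0 : ℝ), (‖p.1.1 i x‖ ^ 2 + W i x * ‖p.1.1 i x‖ ^ 2) :=
          integral_mono hVint.neg ((integrable_norm_sq _).add hWint) hpt
      _ = ‖p.1.1 i‖ ^ 2 + ∫ x in Ioi (0 : ℝ), W i x * ‖p.1.1 i x‖ ^ 2 := by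
          rw [integral_add (integrable_norm_sq _) hWint, norm_sq_eq_integral]
      _ ≤ ‖p.1.1 i‖ ^ 2 + ∫ x in Ioi (0 : ℝ),
            W i x * (2 / δ * ‖p.1.1 i‖ ^ 2 + 2 * δ * ‖p.1.2 i‖ ^ 2) := by
          exact add_le_add le_rfl (integral_mono_ae hWint ((hW i).mul_const _) hsup)
      _ ≤ _ := by
          rw [integral_mul_const]
          gcongr
          exact hAi i
  have hsum := Finset.sum_le_sum fun i (_ : i ∈ Finset.univ) => hedge i
  rw [Finset.sum_neg_distrib, Finset.sum_add_distrib, ← Finset.mul_sum, Finset.sum_add_distrib,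
    ← Finset.mul_sum, ← Finset.mul_sum, ← PiLp.norm_sq_eq_of_L2, ← PiLp.norm_sq_eq_of_L2] at hsum
  rw [re_sesqForm_self, embed_apply]
  have hδA : A * (2 * δ) ≤ 1 / 2 := by
    rw [hδ]
    field_simp
    linarith
  nlinarith [sq_nonneg ‖p.1.2‖]

end

section

/-! ### Compactness -/

/-- A form of Arzelà–Ascoli: a countable product of closed balls gives a subsequence converging at
all nonnegative rationals, and the uniform Hölder bound carries the Cauchy property to every x ≥ 0.
-/
theorem exists_subseq_cauchySeq {κ : Type} [Countable κ] (F : ℕ → κ → ℝ → ℂ) (M K : ℝ)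
    (hM : ∀ n i x, 0 ≤ x → ‖F n i x‖ ≤ M)
    (hK : ∀ n i x y, 0 ≤ x → x ≤ y → ‖F n i y - F n i x‖ ≤ Real.sqrt (y - x) * K) :
    ∃ φ : ℕ → ℕ, StrictMono φ ∧ ∀ i x, 0 ≤ x → CauchySeq fun n => F (φ n) i x := by
  have hcomp : IsCompact (Set.univ.pi fun _ : κ × {q : ℚ // 0 ≤ q} => Metric.closedBall (0 : ℂ) M) :=
    isCompact_univ_pi fun _ => isCompact_closedBall _ _
  obtain ⟨a, -, φ, hφ, hlim⟩ := hcomp.isSeqCompact (x := fun n p => F n p.1 (p.2 : ℚ)) (by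
    intro n p _
    rw [mem_closedBall_zero_iff]
    exact hM _ _ _ (by exact_mod_cast p.2.2))
  refine ⟨φ, hφ, fun i x hx => ?_⟩
  rw [Metric.cauchySeq_iff]
  intro ε hε
  have hcont : Tendsto (fun y => Real.sqrt (y - x) * K) (𝓝 x) (𝓝 0) := by
    have : Continuous fun y : ℝ => Real.sqrt (y - x) * K := by fun_prop
    simpa using this.tendsto x
  obtain ⟨η, hη, hball⟩ := Metric.eventually_nhds_iff.1 (hcont.eventually_lt_const
    (show (0 : ℝ) < ε / 3 by positivity))
  obtain ⟨q, hq1, hq2⟩ := exists_rat_btwn (show x < x + η by linarith)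
  have hq0 : 0 ≤ q := by exact_mod_cast hx.trans hq1.le
  have hsmall : Real.sqrt (q - x) * K < ε / 3 := hball (by
    rw [Real.dist_eq, abs_of_pos (by linarith)]; linarith)
  have hc : CauchySeq fun n => F (φ n) i q :=
    (tendsto_pi_nhds.1 hlim (i, ⟨q, hq0⟩)).cauchySeq
  obtain ⟨N, hN⟩ := Metric.cauchySeq_iff.1 hc (ε / 3) (by positivity)
  refine ⟨N, fun m hm n hn => ?_⟩
  have h1 := hK (φ m) i x q hx hq1.le
  have h2 := hK (φ n) i x q hx hq1.le
  have h3 := hN m hm n hn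
  rw [dist_eq_norm] at h3 ⊢
  have h4 : F (φ m) i x - F (φ n) i x = -(F (φ m) i q - F (φ m) i x) +
      (F (φ m) i q - F (φ n) i q) + (F (φ n) i q - F (φ n) i x) := by ring
  rw [h4]
  refine (norm_add₃_le).trans_lt ?_
  rw [norm_neg]
  linarith

theorem tendsto_rep {c : ℕ → ℂ} {v : ℕ → HalfLineL2} {c₀ : ℂ} {v₀ : HalfLineL2}
    (hc : Tendsto c atTop (𝓝 c₀)) (hv : Tendsto v atTop (𝓝 v₀)) {x : ℝ} (hx : 0 ≤ x) :
    Tendsto (fun n => rep (c n) (v n) x) atTop (𝓝 (rep c₀ v₀ x)) := by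
  rw [tendsto_iff_norm_sub_tendsto_zero] at hc hv ⊢
  have hlim : Tendsto (fun n => ‖c n - c₀‖ + Real.sqrt (x - 0) * ‖v n - v₀‖) atTop (𝓝 0) := by
    simpa using hc.add (hv.const_mul (Real.sqrt (x - 0)))
  refine squeeze_zero (fun _ => norm_nonneg _) (fun n => ?_) hlim
  rw [← rep_sub _ _ _ _ hx, rep]
  exact (norm_add_le _ _).trans (add_le_add le_rfl (norm_intervalIntegral_le _ le_rfl hx))

/-- Closedness of the weak derivative together with the boundary value: L² convergence gives a.e.
convergence along a subsequence, and the continuous representatives converge at every point. -/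
theorem HasDerivTrace.of_tendsto {u v : ℕ → HalfLineL2} {c : ℕ → ℂ} {u₀ v₀ : HalfLineL2} {c₀ : ℂ}
    (h : ∀ n, HasDerivTrace (u n) (v n) (c n)) (hu : Tendsto u atTop (𝓝 u₀))
    (hv : Tendsto v atTop (𝓝 v₀)) (hc : Tendsto c atTop (𝓝 c₀)) : HasDerivTrace u₀ v₀ c₀ := by
  obtain ⟨ns, hns, hae⟩ := (tendstoInMeasure_of_tendsto_Lp hu).exists_seq_tendsto_ae
  filter_upwards [hae, ae_all_iff.2 h, ae_restrict_mem measurableSet_Ioi] with x h1 h2 hx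
  refine tendsto_nhds_unique h1 ?_
  have h3 := (tendsto_rep hc hv (le_of_lt hx)).comp hns.tendsto_atTop
  exact h3.congr fun n => (h2 (ns n)).symm

/-- Fatou's lemma for nonnegative real functions. -/
theorem integrable_and_integral_le_of_tendsto {α : Type*} [MeasurableSpace α] {μ : Measure α}
    {f : ℕ → α → ℝ} {g : α → ℝ} {L : ℝ} (hf : ∀ n, Integrable (f n) μ)
    (hf0 : ∀ n, 0 ≤ᵐ[μ] f n) (hlim : ∀ᵐ x ∂μ, Tendsto (fun n => f n x) atTop (𝓝 (g x)))
    (hL : Tendsto (fun n => ∫ x, f n x ∂μ) atTop (𝓝 L)) : Integrable g μ ∧ ∫ x, g x ∂μ ≤ L := by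
  have hgm : AEStronglyMeasurable g μ :=
    aestronglyMeasurable_of_tendsto_ae atTop (fun n => (hf n).aestronglyMeasurable) hlim
  have hg0 : 0 ≤ᵐ[μ] g := by
    filter_upwards [hlim, ae_all_iff.2 hf0] with x h1 h2
    exact ge_of_tendsto' h1 h2
  have hL0 : 0 ≤ L := ge_of_tendsto' hL fun n => integral_nonneg_of_ae (hf0 n)
  have key : ∫⁻ x, ENNReal.ofReal (g x) ∂μ ≤ ENNReal.ofReal L := by
    calc ∫⁻ x, ENNReal.ofReal (g x) ∂μ
        = ∫⁻ x, liminf (fun n => ENNReal.ofReal (f n x)) atTop ∂μ := by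
          refine lintegral_congr_ae ?_
          filter_upwards [hlim] with x hx
          exact ((ENNReal.continuous_ofReal.tendsto _).comp hx).liminf_eq.symm
      _ ≤ liminf (fun n => ∫⁻ x, ENNReal.ofReal (f n x) ∂μ) atTop :=
          lintegral_liminf_le' fun n => (hf n).aestronglyMeasurable.aemeasurable.ennreal_ofReal
      _ = ENNReal.ofReal L := by
          have : ∀ n, ∫⁻ x, ENNReal.ofReal (f n x) ∂μ = ENNReal.ofReal (∫ x, f n x ∂μ) := fun n =>
            (ofReal_integral_eq_lintegral_ofReal (hf n) (hf0 n)).symm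
          simp only [this]
          exact ((ENNReal.continuous_ofReal.tendsto _).comp hL).liminf_eq
  have hint : Integrable g μ :=
    ⟨hgm, by
      rw [hasFiniteIntegral_iff_ofReal hg0]; exact key.trans_lt ENNReal.ofReal_lt_top⟩
  refine ⟨hint, ?_⟩
  rw [← ofReal_integral_eq_lintegral_ofReal hint hg0] at key
  exact (ENNReal.ofReal_le_ofReal_iff hL0).1 key

/-- The integrable part of the negative part of the potential that is kept as a perturbation. -/
def pert {ι : Type} (V : ι → ℝ → ℝ) (lam : ℝ) (i : ι) (x : ℝ) : ℝ := max ((V i x)⁻ - (-lam / 2)) 0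

/-- After `pert` is added back, the potential of H - λ is at least V₊ - λ/2, hence bounded below by
the positive number -λ/2. -/
theorem posPart_add_le_pert {ι : Type} (V : ι → ℝ → ℝ) (lam : ℝ) (i : ι) (x : ℝ) :
    (V i x)⁺ + -lam / 2 ≤ V i x - lam + pert V lam i x := by
  have h1 := le_max_left ((V i x)⁻ - (-lam / 2)) 0
  have h2 := posPart_sub_negPart (V i x)
  simp only [pert]
  linarith

variable {ι : Type} [Fintype ι] {V : ι → ℝ → ℝ}

/-- The quadratic form of `H - lam`. -/
def shiftedForm (hV : IsPotential V) (lam : ℝ) (p : domain hV) : ℝ :=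
  (sesqForm hV p p).re - lam * ‖embed hV p‖ ^ 2

theorem integrable_coe_mul_norm_sq {hV : IsPotential V} (p : domain hV) (i : ι) :
    Integrable (fun x => V i x * ‖p.1.1 i x‖ ^ 2) halfLineMeasure := by
  refine (integrable_abs_mul_norm_sq p i).mono' ?_ (Eventually.of_forall fun x => ?_)
  · exact (hV.aestronglyMeasurable i).mul ((aestronglyMeasurable_coe _).norm.pow 2)
  · rw [norm_mul, norm_pow, norm_norm, Real.norm_eq_abs]

theorem norm_sq_eq_sum_integral (u : StarL2 ι) :
    ‖u‖ ^ 2 = ∑ i, ∫ x in Ioi (0 : ℝ), ‖u i x‖ ^ 2 := by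
  rw [PiLp.norm_sq_eq_of_L2]
  exact Finset.sum_congr rfl fun i _ => norm_sq_eq_integral _

theorem integrable_pert_mul {hV : IsPotential V} {lam : ℝ} (hlam : lam < 0) (p : domain hV) (i : ι) :
    Integrable (fun x => pert V lam i x * ‖p.1.1 i x‖ ^ 2) halfLineMeasure := by
  obtain ⟨c, hc⟩ := p.2.1
  exact integrable_mul_norm_sq
    (hV.integrable_truncation i (show 0 < -lam / 2 by linarith)) (hc i)

/-- Splits the form of H - λ into a nonnegative part, to which Fatou's lemma applies, and an
integrable perturbation, to which dominated convergence applies. -/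
theorem shiftedForm_eq {hV : IsPotential V} {lam : ℝ} (hlam : lam < 0) (p : domain hV) :
    shiftedForm hV lam p = ‖p.1.2‖ ^ 2 +
      (∫ x in Ioi (0 : ℝ), ∑ i, (V i x - lam + pert V lam i x) * ‖p.1.1 i x‖ ^ 2) -
      ∑ i, ∫ x in Ioi (0 : ℝ), pert V lam i x * ‖p.1.1 i x‖ ^ 2 := by
  have hW := integrable_pert_mul hlam p
  have h2 : ∀ i, ∀ x, (V i x - lam + pert V lam i x) * ‖p.1.1 i x‖ ^ 2 =
      V i x * ‖p.1.1 i x‖ ^ 2 - lam * ‖p.1.1 i x‖ ^ 2 + pert V lam i x * ‖p.1.1 i x‖ ^ 2 :=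
    fun i x => by ring
  have h3 : ∀ i, Integrable (fun x => V i x * ‖p.1.1 i x‖ ^ 2 - lam * ‖p.1.1 i x‖ ^ 2)
      halfLineMeasure := fun i =>
    (integrable_coe_mul_norm_sq p i).sub ((integrable_norm_sq _).const_mul _)
  simp only [h2]
  have h5 : ∀ i, Integrable (fun x => V i x * ‖p.1.1 i x‖ ^ 2 - lam * ‖p.1.1 i x‖ ^ 2 +
      pert V lam i x * ‖p.1.1 i x‖ ^ 2) halfLineMeasure := fun i => (h3 i).add (hW i)
  rw [integral_finsetSum _ fun i _ => h5 i]
  have h4 : ∀ i, ∫ x in Ioi (0 : ℝ), (V i x * ‖p.1.1 i x‖ ^ 2 - lam * ‖p.1.1 i x‖ ^ 2 +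
      pert V lam i x * ‖p.1.1 i x‖ ^ 2) = (∫ x in Ioi (0 : ℝ), V i x * ‖p.1.1 i x‖ ^ 2) -
        lam * (∫ x in Ioi (0 : ℝ), ‖p.1.1 i x‖ ^ 2) +
        ∫ x in Ioi (0 : ℝ), pert V lam i x * ‖p.1.1 i x‖ ^ 2 := by
    intro i
    rw [integral_add (h3 i) (hW i), integral_sub (integrable_coe_mul_norm_sq p i)
      ((integrable_norm_sq _).const_mul _), integral_const_mul]
  simp only [h4, Finset.sum_add_distrib, Finset.sum_sub_distrib, ← Finset.mul_sum]
  rw [← norm_sq_eq_sum_integral, shiftedForm, re_sesqForm_self, embed_apply]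
  ring

theorem integrable_sum_pert {hV : IsPotential V} {lam : ℝ} (hlam : lam < 0) (p : domain hV) :
    Integrable (fun x => ∑ i, (V i x - lam + pert V lam i x) * ‖p.1.1 i x‖ ^ 2)
      halfLineMeasure := by
  refine integrable_finsetSum _ fun i _ => ?_
  have hW := integrable_pert_mul hlam p i
  refine (((integrable_coe_mul_norm_sq p i).sub ((integrable_norm_sq (p.1.1 i)).const_mul lam)).add
    hW).congr (Eventually.of_forall fun x => ?_)
  simp only [Pi.add_apply, Pi.sub_apply]
  ring

theorem norm_sq_le_shiftedForm {hV : IsPotential V} {lam : ℝ} (hlam : lam < 0) (p : domain hV) :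
    ‖p.1.2‖ ^ 2 + -lam / 2 * ‖p.1.1‖ ^ 2 ≤ shiftedForm hV lam p +
      ∑ i, ∫ x in Ioi (0 : ℝ), pert V lam i x * ‖p.1.1 i x‖ ^ 2 := by
  have h1 : -lam / 2 * ‖p.1.1‖ ^ 2 ≤
      ∫ x in Ioi (0 : ℝ), ∑ i, (V i x - lam + pert V lam i x) * ‖p.1.1 i x‖ ^ 2 := by
    rw [norm_sq_eq_sum_integral, ← integral_finsetSum _ fun i _ => integrable_norm_sq (p.1.1 i),
      ← integral_const_mul]
    refine integral_mono ((integrable_finsetSum _ fun i _ => integrable_norm_sq _).const_mul _)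
      (integrable_sum_pert hlam p) fun x => ?_
    simp only [Finset.mul_sum]
    refine Finset.sum_le_sum fun i _ => mul_le_mul_of_nonneg_right ?_ (sq_nonneg _)
    have := posPart_add_le_pert V lam i x
    have := posPart_nonneg (V i x)
    linarith
  rw [shiftedForm_eq hlam]
  linarith

/-- Compactness of an integrable weight: an a.e. limit and a uniform sup bound suffice. The general
filter permits double sequences, as needed for a Cauchy criterion. -/
theorem tendsto_integral_mul_norm_sq {w : ℝ → ℝ} (hw : Integrable w halfLineMeasure) {β : Type}
    {l : Filter β} [l.IsCountablyGenerated] {u : β → HalfLineL2} {g : ℝ → ℂ} {M : ℝ}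
    (hM : ∀ n, ∀ᵐ x ∂halfLineMeasure, ‖u n x‖ ^ 2 ≤ M)
    (hlim : ∀ᵐ x ∂halfLineMeasure, Tendsto (fun n => u n x) l (𝓝 (g x))) :
    Tendsto (fun n => ∫ x in Ioi (0 : ℝ), w x * ‖u n x‖ ^ 2) l
      (𝓝 (∫ x in Ioi (0 : ℝ), w x * ‖g x‖ ^ 2)) := by
  refine tendsto_integral_filter_of_dominated_convergence (fun x => ‖w x‖ * M) ?_ ?_
    (hw.norm.mul_const M) ?_
  · exact Eventually.of_forall fun n =>
      hw.aestronglyMeasurable.mul ((aestronglyMeasurable_coe _).norm.pow 2)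
  · refine Eventually.of_forall fun n => ?_
    filter_upwards [hM n] with x hx
    rw [norm_mul, norm_pow, norm_norm]
    exact mul_le_mul_of_nonneg_left hx (norm_nonneg _)
  · filter_upwards [hlim] with x hx
    exact ((hx.norm.pow 2).const_mul _)

/-- The `L²`-normalised sequences along which `H - lam` is small are precompact. -/
theorem exists_subseq_tendsto (hV : IsPotential V) {lam : ℝ} (hlam : lam < 0)
    (x : ℕ → domain hV) (hx : ∀ n, ‖embed hV (x n)‖ = 1)
    (hQ : Tendsto (fun n => shiftedForm hV lam (x n)) atTop (𝓝 0))
    (hpar : ∀ n m, shiftedForm hV lam (x n - x m) ≤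
      2 * (shiftedForm hV lam (x n) + shiftedForm hV lam (x m))) :
    ∃ (y : domain hV) (φ : ℕ → ℕ), StrictMono φ ∧
      Tendsto (fun n => embed hV (x (φ n))) atTop (𝓝 (embed hV y)) ∧ shiftedForm hV lam y ≤ 0 := by
  have hne : Nonempty ι := by
    by_contra h
    rw [not_nonempty_iff] at h
    have h1 := hx 0
    have : embed hV (x 0) = 0 := by ext i; exact h.elim i
    rw [this] at h1; simp at h1
  have hε : 0 < -lam / 2 := by linarith
  choose c hc using fun n => (x n).2.1
  obtain ⟨K, hK⟩ : ∃ K, ∀ n, ‖(x n).1.2‖ ^ 2 ≤ K := by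
    obtain ⟨C, -, hC⟩ := exists_half_norm_deriv_sq_le hV
    obtain ⟨B, hB⟩ := hQ.bddAbove_range
    refine ⟨2 * (B + lam + C), fun n => ?_⟩
    have h1 := hC (x n)
    have h2 : shiftedForm hV lam (x n) ≤ B := hB ⟨n, rfl⟩
    rw [shiftedForm, hx] at h2
    rw [hx] at h1
    linarith
  have hK' : ∀ n i, ‖(x n).1.2 i‖ ^ 2 ≤ K := fun n i =>
    (pow_le_pow_left₀ (norm_nonneg _) (PiLp.norm_apply_le _ i) 2).trans (hK n)
  have hu' : ∀ n i, ‖(x n).1.1 i‖ ^ 2 ≤ 1 := fun n i => by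
    have h := pow_le_pow_left₀ (norm_nonneg _) (PiLp.norm_apply_le (x n).1.1 i) 2
    have h2 : ‖(x n).1.1‖ = 1 := hx n
    rw [h2] at h; simpa using h
  have hsup : ∀ n i t, 0 ≤ t → ‖rep (c n) ((x n).1.2 i) t‖ ^ 2 ≤ 2 + 2 * K := fun n i t ht => by
    have := norm_rep_sq_le (hc n i) ht
    linarith [hK' n i, hu' n i]
  obtain ⟨φ, hφ, hcau⟩ := exists_subseq_cauchySeq (fun n i t => rep (c n) ((x n).1.2 i) t)
    (Real.sqrt (2 + 2 * K)) (Real.sqrt K)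
    (fun n i t ht => Real.le_sqrt_of_sq_le (hsup n i t ht))
    (fun n i s t hs hst => (norm_rep_sub_rep_le _ _ hs hst).trans
      (mul_le_mul_of_nonneg_left (Real.le_sqrt_of_sq_le (hK' n i)) (Real.sqrt_nonneg _)))
  set y : ℕ → domain hV := fun n => x (φ n) with hy
  have hQy : Tendsto (fun n => shiftedForm hV lam (y n)) atTop (𝓝 0) := hQ.comp hφ.tendsto_atTop
  have hptw : ∀ n i, ∀ᵐ t ∂halfLineMeasure, (y n).1.1 i t = rep (c (φ n)) ((y n).1.2 i) t :=
    fun n i => hc (φ n) i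
  have hdiff : Tendsto (fun nm : ℕ × ℕ => ∑ i, ∫ t in Ioi (0 : ℝ),
      pert V lam i t * ‖(y nm.1 - y nm.2).1.1 i t‖ ^ 2) atTop (𝓝 0) := by
    have h0 : 𝓝 (0 : ℝ) = 𝓝 (∑ i : ι, ∫ t in Ioi (0 : ℝ), pert V lam i t * ‖(0 : ℂ)‖ ^ 2) := by
      simp
    rw [h0]
    refine tendsto_finsetSum _ fun i _ => ?_
    refine tendsto_integral_mul_norm_sq (hV.integrable_truncation i hε) (l := atTop) (M := 4 * (2 + 2 * K))
      (u := fun nm : ℕ × ℕ => (y nm.1 - y nm.2).1.1 i) (g := fun _ => 0) ?_ ?_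
    · intro nm
      filter_upwards [hptw nm.1 i, hptw nm.2 i, Lp.coeFn_sub ((y nm.1).1.1 i) ((y nm.2).1.1 i),
        ae_restrict_mem measurableSet_Ioi] with t h1 h2 h3 ht
      have h4 : (y nm.1 - y nm.2).1.1 i t = (y nm.1).1.1 i t - (y nm.2).1.1 i t := h3
      rw [h4, h1, h2, sub_eq_add_neg]
      have h5 := norm_add_sq_le_two_mul (rep (c (φ nm.1)) ((y nm.1).1.2 i) t)
        (-rep (c (φ nm.2)) ((y nm.2).1.2 i) t)
      rw [norm_neg] at h5
      linarith [hsup (φ nm.1) i t (le_of_lt ht), hsup (φ nm.2) i t (le_of_lt ht)]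
    · filter_upwards [ae_all_iff.2 fun n => hptw n i,
        ae_all_iff.2 fun nm : ℕ × ℕ => Lp.coeFn_sub ((y nm.1).1.1 i) ((y nm.2).1.1 i),
        ae_restrict_mem measurableSet_Ioi] with t h1 h3 ht
      rw [tendsto_zero_iff_norm_tendsto_zero]
      refine (cauchySeq_iff_tendsto_dist_atTop_0.1 (hcau i t (le_of_lt ht))).congr fun nm => ?_
      have h4 : (y nm.1 - y nm.2).1.1 i t = (y nm.1).1.1 i t - (y nm.2).1.1 i t := h3 nm
      rw [h4, h1, h1, dist_eq_norm]
  -- Coercivity bounds the H¹ distance of two terms by the form of their difference plus the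
  -- perturbation. The former tends to 0 by `hpar`, the latter by pointwise convergence.
  have hB : Tendsto (fun nm : ℕ × ℕ => ‖(y nm.1 - y nm.2).1.2‖ ^ 2 +
      -lam / 2 * ‖(y nm.1 - y nm.2).1.1‖ ^ 2) atTop (𝓝 0) := by
    have h1 : Tendsto (fun nm : ℕ × ℕ => 2 * (shiftedForm hV lam (y nm.1) +
        shiftedForm hV lam (y nm.2)) + ∑ i, ∫ t in Ioi (0 : ℝ),
      pert V lam i t * ‖(y nm.1 - y nm.2).1.1 i t‖ ^ 2) atTop (𝓝 0) := by
      have h2 := (((hQy.comp tendsto_fst).add (hQy.comp tendsto_snd)).const_mul 2)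
      rw [prod_atTop_atTop_eq] at h2
      simpa using h2.add hdiff
    refine squeeze_zero (fun nm => by positivity) (fun nm => ?_) h1
    refine (norm_sq_le_shiftedForm hlam _).trans (add_le_add (hpar _ _) le_rfl)
  have hcau2 : CauchySeq fun n => (y n).1.2 := by
    rw [cauchySeq_iff_tendsto_dist_atTop_0]
    have h1 : Tendsto (fun nm : ℕ × ℕ => dist (y nm.1).1.2 (y nm.2).1.2 ^ 2) atTop (𝓝 0) := by
      refine squeeze_zero (fun nm => by positivity) (fun nm => ?_) hB
      rw [dist_eq_norm]
      have : 0 ≤ -lam / 2 * ‖(y nm.1 - y nm.2).1.1‖ ^ 2 := by positivity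
      exact le_add_of_nonneg_right this
    simpa [Function.comp_def, Real.sqrt_sq] using (Real.continuous_sqrt.tendsto 0).comp h1
  have hcau1 : CauchySeq fun n => (y n).1.1 := by
    rw [cauchySeq_iff_tendsto_dist_atTop_0]
    have h1 : Tendsto (fun nm : ℕ × ℕ => dist (y nm.1).1.1 (y nm.2).1.1 ^ 2) atTop (𝓝 0) := by
      have h2 := hB.const_mul (-lam / 2)⁻¹
      rw [mul_zero] at h2
      refine squeeze_zero (fun nm => by positivity) (fun nm => ?_) h2
      rw [dist_eq_norm, mul_add, inv_mul_cancel_left₀ hε.ne']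
      have : 0 ≤ (-lam / 2)⁻¹ * ‖(y nm.1 - y nm.2).1.2‖ ^ 2 := by positivity
      exact le_add_of_nonneg_left this
    simpa [Function.comp_def, Real.sqrt_sq] using (Real.continuous_sqrt.tendsto 0).comp h1
  obtain ⟨v, hv⟩ := cauchySeq_tendsto_of_complete hcau2
  obtain ⟨u, hu⟩ := cauchySeq_tendsto_of_complete hcau1
  obtain ⟨c₀, hc₀⟩ : ∃ c₀, Tendsto (fun n => c (φ n)) atTop (𝓝 c₀) := by
    have h := hcau hne.some 0 le_rfl
    simp only [rep, intervalIntegral.integral_same, add_zero] at h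
    exact cauchySeq_tendsto_of_complete h
  have hvi : ∀ i, Tendsto (fun n => (y n).1.2 i) atTop (𝓝 (v i)) := fun i =>
    ((PiLp.continuous_apply 2 _ i).tendsto v).comp hv
  have hui : ∀ i, Tendsto (fun n => (y n).1.1 i) atTop (𝓝 (u i)) := fun i =>
    ((PiLp.continuous_apply 2 _ i).tendsto u).comp hu
  have htr : ∀ i, HasDerivTrace (u i) (v i) c₀ := fun i =>
    HasDerivTrace.of_tendsto (fun n => hc (φ n) i) (hui i) (hvi i) hc₀
  have hlim : ∀ i, ∀ᵐ t ∂halfLineMeasure, Tendsto (fun n => (y n).1.1 i t) atTop (𝓝 (u i t)) := by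
    intro i
    filter_upwards [ae_all_iff.2 fun n => hptw n i, htr i, ae_restrict_mem measurableSet_Ioi]
      with t h1 h2 ht
    have h3 : u i t = rep c₀ (v i) t := h2
    simp only [h1, h3]
    exact tendsto_rep hc₀ (hvi i) (le_of_lt ht)
  have hk : Tendsto (fun n => ∑ i, ∫ t in Ioi (0 : ℝ), pert V lam i t * ‖(y n).1.1 i t‖ ^ 2)
      atTop (𝓝 (∑ i, ∫ t in Ioi (0 : ℝ), pert V lam i t * ‖u i t‖ ^ 2)) := by
    refine tendsto_finsetSum _ fun i _ => ?_
    refine tendsto_integral_mul_norm_sq (hV.integrable_truncation i hε) (l := atTop) (M := 2 + 2 * K)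
      (fun n => ?_) (hlim i)
    filter_upwards [hptw n i, ae_restrict_mem measurableSet_Ioi] with t h1 ht
    rw [h1]; exact hsup (φ n) i t (le_of_lt ht)
  have hL : Tendsto (fun n => ∫ t in Ioi (0 : ℝ), ∑ i, (V i t - lam + pert V lam i t) *
      ‖(y n).1.1 i t‖ ^ 2) atTop (𝓝 (0 - ‖v‖ ^ 2 +
        ∑ i, ∫ t in Ioi (0 : ℝ), pert V lam i t * ‖u i t‖ ^ 2)) := by
    refine ((hQy.sub (hv.norm.pow 2)).add hk).congr fun n => ?_
    rw [shiftedForm_eq hlam]; ring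
  have hUnn : ∀ i t, 0 ≤ V i t - lam + pert V lam i t := fun i t => by
    have := posPart_add_le_pert V lam i t
    have := posPart_nonneg (V i t)
    linarith
  -- The V₊ term is only lower semicontinuous. Fatou's lemma yields both membership of the limit in
  -- the form domain and the inequality for its energy.
  obtain ⟨hint, hle⟩ := integrable_and_integral_le_of_tendsto
    (g := fun t => ∑ i, (V i t - lam + pert V lam i t) * ‖u i t‖ ^ 2)
    (fun n => integrable_sum_pert hlam (y n))
    (fun n => Eventually.of_forall fun t => Finset.sum_nonneg fun i _ =>
      mul_nonneg (hUnn i t) (sq_nonneg _))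
    (by
      filter_upwards [ae_all_iff.2 hlim] with t ht
      exact tendsto_finsetSum _ fun i _ => ((ht i).norm.pow 2).const_mul _) hL
  have hmem : (u, v) ∈ domain hV := by
    refine ⟨⟨c₀, htr⟩, fun i => hint.mono' ?_ (Eventually.of_forall fun t => ?_)⟩
    · exact (hV.aestronglyMeasurable_posPart i).mul ((aestronglyMeasurable_coe _).norm.pow 2)
    · rw [Real.norm_of_nonneg (mul_nonneg (posPart_nonneg _) (sq_nonneg _))]
      refine le_trans ?_ (Finset.single_le_sum
        (f := fun i => (V i t - lam + pert V lam i t) * ‖u i t‖ ^ 2)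
        (fun j _ => mul_nonneg (hUnn j t) (sq_nonneg _)) (Finset.mem_univ i))
      refine mul_le_mul_of_nonneg_right ?_ (sq_nonneg _)
      linarith [posPart_add_le_pert V lam i t]
  refine ⟨⟨(u, v), hmem⟩, φ, hφ, hu, ?_⟩
  rw [shiftedForm_eq hlam]
  simp only
  linarith

end

section

/-! ### The variational principle -/

theorem eq_zero_of_forall_nonneg_quadratic {a b : ℝ} (h : ∀ t : ℝ, 0 ≤ 2 * t * a + t ^ 2 * b) :
    a = 0 := by
  by_contra ha
  have hb : 0 ≤ b := by
    have h1 := h 1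
    have h2 := h (-1)
    linarith
  -- The minimiser would be -a/b; the shift by 1 also covers b = 0.
  have h3 := h (-a / (b + 1))
  have hb1 : 0 < b + 1 := by linarith
  have h4 : 2 * (-a / (b + 1)) * a + (-a / (b + 1)) ^ 2 * b = -(a ^ 2 * (b + 2)) / (b + 1) ^ 2 := by
    field_simp
    ring
  rw [h4] at h3
  have h5 : 0 < a ^ 2 * (b + 2) / (b + 1) ^ 2 := by positivity
  rw [neg_div] at h3
  linarith

/-- A null vector of a nonnegative form minimises it, so the first variation vanishes. Varying along
x gives the real part, along ix the imaginary part. -/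
theorem sesq_eq_zero_of_re_self_eq_zero {D : Type*} [AddCommGroup D] [Module ℂ D]
    (B : D →ₗ⋆[ℂ] D →ₗ[ℂ] ℂ) (hB : ∀ x y, conj (B x y) = B y x) (X : Submodule ℂ D)
    (hX : ∀ x ∈ X, 0 ≤ (B x x).re) {y : D} (hy : y ∈ X) (hy0 : (B y y).re = 0) {x : D}
    (hx : x ∈ X) : B x y = 0 := by
  have hre : ∀ x ∈ X, (B x y).re = 0 := by
    intro x hx
    refine eq_zero_of_forall_nonneg_quadratic (b := (B x x).re) fun t => ?_
    have h1 := hX _ (X.add_mem hy (X.smul_mem (t : ℂ) hx))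
    have h2 : (B y x).re = (B x y).re := by rw [← hB x y, Complex.conj_re]
    simp only [map_add, map_smulₛₗ, LinearMap.add_apply, LinearMap.smul_apply, smul_eq_mul,
      Complex.conj_ofReal, RingHom.id_apply, Complex.add_re, Complex.re_ofReal_mul, hy0, h2] at h1
    nlinarith
  have him := hre _ (X.smul_mem Complex.I hx)
  simp only [map_smulₛₗ, LinearMap.smul_apply, smul_eq_mul, Complex.conj_I, Complex.mul_re,
    Complex.neg_re, Complex.I_re, Complex.neg_im, Complex.I_im] at him
  exact Complex.ext (hre x hx) (by simpa using him)

variable {ι : Type} [Fintype ι] {V : ι → ℝ → ℝ}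

/-- The sesquilinear form of `H - lam`. -/
def shiftedSesq (hV : IsPotential V) (lam : ℝ) : domain hV →ₗ⋆[ℂ] domain hV →ₗ[ℂ] ℂ :=
  sesqForm hV - (lam : ℂ) • ((innerₛₗ ℂ).compl₂ (embed hV)).comp (embed hV)

theorem shiftedSesq_apply {hV : IsPotential V} {lam : ℝ} (p q : domain hV) :
    shiftedSesq hV lam p q = sesqForm hV p q - lam * inner ℂ (embed hV p) (embed hV q) := rfl

theorem conj_shiftedSesq {hV : IsPotential V} {lam : ℝ} (p q : domain hV) :
    conj (shiftedSesq hV lam p q) = shiftedSesq hV lam q p := by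
  rw [shiftedSesq_apply, shiftedSesq_apply, map_sub, map_mul, conj_sesqForm, inner_conj_symm,
    Complex.conj_ofReal]

theorem re_shiftedSesq_self {hV : IsPotential V} {lam : ℝ} (p : domain hV) :
    (shiftedSesq hV lam p p).re = shiftedForm hV lam p := by
  rw [shiftedSesq_apply, shiftedForm, Complex.sub_re, Complex.re_ofReal_mul,
    inner_self_eq_norm_sq_to_K]
  norm_cast

theorem shiftedForm_smul {hV : IsPotential V} {lam : ℝ} (k : ℝ) (p : domain hV) :
    shiftedForm hV lam ((k : ℂ) • p) = k ^ 2 * shiftedForm hV lam p := by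
  rw [← re_shiftedSesq_self, ← re_shiftedSesq_self]
  simp only [map_smulₛₗ, LinearMap.smul_apply, smul_eq_mul, Complex.conj_ofReal, RingHom.id_apply,
    Complex.re_ofReal_mul]
  ring

theorem shiftedForm_add_add_sub {hV : IsPotential V} {lam : ℝ} (p q : domain hV) :
    shiftedForm hV lam (p + q) + shiftedForm hV lam (p - q) =
      2 * (shiftedForm hV lam p + shiftedForm hV lam q) := by
  simp only [← re_shiftedSesq_self, map_add, map_sub, LinearMap.add_apply, LinearMap.sub_apply,
    Complex.add_re, Complex.sub_re]
  ring

/-- On the orthogonal complement of the eigenvectors with eigenvalues below `E < 0`, the form is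
bounded from below by `E`. -/
theorem shiftedForm_nonneg_of_orthogonal (hV : IsPotential V) (F : Submodule ℂ (StarL2 ι))
    [FiniteDimensional ℂ F] (hF : ∀ f ∈ F, ∃ g ∈ F, IsSchrodinger V f g) {E : ℝ} (hE : E < 0)
    (hmem : ∀ lam < E, eigenspace V lam ≤ F) (p : domain hV) (hp : embed hV p ∈ Fᗮ) :
    0 ≤ shiftedForm hV E p := by
  by_contra! hneg
  obtain ⟨C, hC0, hC⟩ := exists_half_norm_deriv_sq_le hV
  set X : Submodule ℂ (domain hV) := Fᗮ.comap (embed hV) with hX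
  set S : Set ℝ := {r | ∃ q ∈ X, ‖embed hV q‖ = 1 ∧ (sesqForm hV q q).re = r} with hS
  have hbdd : BddBelow S := by
    refine ⟨-C, ?_⟩
    rintro r ⟨q, -, hq, rfl⟩
    have h1 := hC q
    rw [hq] at h1
    nlinarith [sq_nonneg ‖q.1.2‖]
  have hnorm : ∀ q : domain hV, ‖embed hV q‖ ≠ 0 →
      ‖embed hV (((‖embed hV q‖⁻¹ : ℝ) : ℂ) • q)‖ = 1 := by
    intro q hq
    rw [map_smul, norm_smul, Complex.norm_real, norm_inv, norm_norm, inv_mul_cancel₀ hq]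
  have hform : ∀ (lam : ℝ) (q : domain hV), ‖embed hV q‖ = 1 →
      (sesqForm hV q q).re = shiftedForm hV lam q + lam := by
    intro lam q hq
    rw [shiftedForm, hq]; ring
  have hnonneg0 : ∀ (lam : ℝ) (q : domain hV), ‖embed hV q‖ = 0 → 0 ≤ shiftedForm hV lam q := by
    intro lam q hq
    have h1 := hC q
    rw [shiftedForm]
    rw [hq] at h1 ⊢
    nlinarith [sq_nonneg ‖q.1.2‖]
  have hp0 : ‖embed hV p‖ ≠ 0 := fun h => absurd (hnonneg0 E p h) (not_le.2 hneg)
  have hpS : (sesqForm hV _ (((‖embed hV p‖⁻¹ : ℝ) : ℂ) • p)).re ∈ S :=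
    ⟨_, X.smul_mem _ hp, hnorm p hp0, rfl⟩
  -- The infimum of the Rayleigh quotient over Fᗮ; the normalised `p` shows that it lies below E.
  set lam : ℝ := sInf S with hlamdef
  have hlamE : lam < E := by
    refine (csInf_le hbdd hpS).trans_lt ?_
    rw [hform E _ (hnorm p hp0), shiftedForm_smul]
    have : 0 < (‖embed hV p‖⁻¹) ^ 2 := by positivity
    nlinarith
  have hnonneg : ∀ q ∈ X, 0 ≤ shiftedForm hV lam q := by
    intro q hq
    by_cases hq0 : ‖embed hV q‖ = 0
    · exact hnonneg0 _ _ hq0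
    · have h1 : lam ≤ _ := csInf_le hbdd ⟨_, X.smul_mem _ hq, hnorm q hq0, rfl⟩
      rw [hform lam _ (hnorm q hq0), shiftedForm_smul] at h1
      have h2 : 0 < (‖embed hV q‖⁻¹) ^ 2 := by positivity
      by_contra! h3
      nlinarith
  obtain ⟨r, -, hr, hrS⟩ := exists_seq_tendsto_sInf ⟨_, hpS⟩ hbdd
  choose x hxX hx1 hxr using hrS
  -- A minimising sequence. The condition on differences is the parallelogram law, because the form
  -- at the sum is nonnegative.
  obtain ⟨y, φ, -, hy, hyle⟩ := exists_subseq_tendsto hV (hlamE.trans hE) x hx1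
    (by
      have h1 : Tendsto (fun n => r n - lam) atTop (𝓝 (lam - lam)) := hr.sub_const lam
      rw [sub_self] at h1
      refine h1.congr fun n => ?_
      rw [← hxr, hform lam _ (hx1 n)]; ring)
    (by
      intro n m
      have h1 := shiftedForm_add_add_sub (lam := lam) (x n) (x m)
      have h2 := hnonneg _ (X.add_mem (hxX n) (hxX m))
      linarith)
  have hyX : y ∈ X :=
    (Submodule.isClosed_orthogonal F).mem_of_tendsto hy (Eventually.of_forall fun n => hxX (φ n))
  have hy1 : ‖embed hV y‖ = 1 := tendsto_nhds_unique hy.norm (by simp [hx1])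
  have hy0 : shiftedForm hV lam y = 0 := le_antisymm hyle (hnonneg y hyX)
  have hXzero : ∀ q ∈ X, shiftedSesq hV lam q y = 0 := fun q hq =>
    sesq_eq_zero_of_re_self_eq_zero (shiftedSesq hV lam) conj_shiftedSesq X
      (fun z hz => by rw [re_shiftedSesq_self]; exact hnonneg z hz) hyX
      (by rw [re_shiftedSesq_self, hy0]) hq
  have hyorth : ∀ f ∈ F, inner ℂ (embed hV y) f = 0 := fun f hf =>
    Submodule.inner_left_of_mem_orthogonal hf hyX
  have heig : embed hV y ∈ eigenspace V lam := by
    rw [mem_eigenspace hV, isSchrodinger_iff hV]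
    refine ⟨y, rfl, fun q => ?_⟩
    -- The Euler–Lagrange equation is known only for test functions in X. The F-component of a
    -- general q lies in dom H and is mapped by H into F, so it contributes nothing against y ⊥ F.
    obtain ⟨g, hg, hw⟩ := hF _ (F.starProjection_apply_mem (embed hV q))
    obtain ⟨w, hwf, hwg⟩ := (isSchrodinger_iff hV).1 hw
    have h1 : q - w ∈ X := by
      change embed hV (q - w) ∈ Fᗮ
      rw [map_sub, hwf]
      exact F.sub_starProjection_mem_orthogonal _
    have h2 : shiftedSesq hV lam w y = 0 := by
      rw [← conj_shiftedSesq, shiftedSesq_apply, hwg, hyorth g hg, hwf,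
        hyorth _ (F.starProjection_apply_mem _)]
      simp
    have h3 : shiftedSesq hV lam q y = 0 := by
      have := hXzero _ h1
      rwa [map_sub, LinearMap.sub_apply, h2, sub_zero] at this
    rw [shiftedSesq_apply, sub_eq_zero] at h3
    rw [h3, inner_smul_right]
  -- Now y is an eigenvector below E, hence in F, and also orthogonal to F.
  have hself := hyorth _ (hmem lam hlamE heig)
  rw [inner_self_eq_zero] at hself
  rw [hself, norm_zero] at hy1
  exact zero_ne_one hy1

end

section

/-! ### Counting eigenvalues -/

/-- Cap every term at k. If all finite sums of capped terms stay below k, no term was actually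
capped, and the full sum is at most k - 1. -/
theorem exists_finset_sum_of_le_tsum {α : Type*} (g : α → ℕ∞) (k : ℕ)
    (h : (k : ℝ≥0∞) ≤ ∑' a, (g a : ℝ≥0∞)) :
    ∃ (s : Finset α) (m : α → ℕ), (∀ a, (m a : ℕ∞) ≤ g a) ∧ k ≤ ∑ a ∈ s, m a := by
  have hm : ∀ a, ((min (g a) k).toNat : ℕ∞) = min (g a) k := fun a =>
    ENat.natCast_toNat (ne_of_lt (lt_of_le_of_lt (min_le_right _ _) (ENat.natCast_lt_top k)))
  by_contra! hcon
  have hcon' := fun s => hcon s (fun a => (min (g a) k).toNat)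
    (fun a => by rw [hm]; exact min_le_left _ _)
  have hlt : ∀ a, g a = (min (g a) k).toNat := by
    intro a
    have h1 := hcon' {a}
    rw [Finset.sum_singleton] at h1
    rw [hm]
    refine (min_eq_left ?_).symm
    by_contra! h2
    have h3 := hm a
    rw [min_eq_right h2.le] at h3 h1
    rw [ENat.toNat_natCast] at h1
    exact lt_irrefl _ h1
  have hk : 0 < k := by simpa using hcon' ∅
  have h4 : ∑' a, (g a : ℝ≥0∞) ≤ ((k - 1 : ℕ) : ℝ≥0∞) := by
    rw [ENNReal.tsum_eq_iSup_sum]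
    refine iSup_le fun s => ?_
    have h5 : ∑ a ∈ s, (g a : ℝ≥0∞) = ((∑ a ∈ s, (min (g a) k).toNat : ℕ) : ℝ≥0∞) := by
      push_cast
      refine Finset.sum_congr rfl fun a _ => ?_
      conv_lhs => rw [hlt a]
      simp
    rw [h5, Nat.cast_le]
    exact Nat.le_sub_one_of_lt (hcon' s)
  have h6 := h.trans h4
  rw [Nat.cast_le] at h6
  omega

variable {ι : Type} [Fintype ι] {V : ι → ℝ → ℝ}

/-- The number of eigenvalues below `min E 0`, counted with multiplicity. -/
def count (V : ι → ℝ → ℝ) (E : ℝ) : ℝ≥0∞ :=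
  ∑' lam : Iio (0 : ℝ), ((if (lam : ℝ) < E then multiplicity V lam else 0 : ℕ∞) : ℝ≥0∞)

theorem count_mono (V : ι → ℝ → ℝ) : Monotone (count V) := by
  intro E E' h
  refine ENNReal.tsum_le_tsum fun lam => ?_
  rw [ENat.toENNReal_le]
  split_ifs with h1 h2
  · exact le_rfl
  · exact absurd (h1.trans_le h) h2
  · exact zero_le
  · exact le_rfl

theorem finrank_finset_sup_le {K E α : Type*} [DivisionRing K] [AddCommGroup E] [Module K E]
    (s : Finset α) (S : α → Submodule K E) (hS : ∀ a ∈ s, FiniteDimensional K (S a)) :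
    FiniteDimensional K (s.sup S : Submodule K E) ∧
      Module.finrank K (s.sup S : Submodule K E) ≤ ∑ a ∈ s, Module.finrank K (S a) := by
  classical
  induction s using Finset.induction_on with
  | empty =>
    have h : (∅ : Finset α).sup S = ⊥ := Finset.sup_empty
    rw [h]
    exact ⟨inferInstance, by simp⟩
  | insert a s ha ih =>
    obtain ⟨h1, h2⟩ := ih fun b hb => hS b (Finset.mem_insert_of_mem hb)
    have h3 := hS a (Finset.mem_insert_self a s)
    rw [Finset.sup_insert, Finset.sum_insert ha]
    exact ⟨inferInstance, (Submodule.finrank_add_le_finrank_add_finrank _ _).trans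
      (Nat.add_le_add_left h2 _)⟩

theorem exists_spectral_subspace (hV : IsPotential V) {E : ℝ} (hE : E < 0)
    (hfin : count V E ≠ ∞) :
    ∃ F : Submodule ℂ (StarL2 ι), FiniteDimensional ℂ F ∧
      (∀ f ∈ F, ∃ g ∈ F, IsSchrodinger V f g) ∧ (∀ lam < E, eigenspace V lam ≤ F) ∧
      (Module.finrank ℂ F : ℝ≥0∞) ≤ count V E := by
  -- Each eigenvalue contributes at least 1 to a finite sum, so only finitely many lie below E.
  have hs := ENNReal.finite_const_le_of_tsum_ne_top hfin one_ne_zero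
  set s : Finset (Iio (0 : ℝ)) := hs.toFinset with hsdef
  have hterm : ∀ lam : Iio (0 : ℝ),
      ((if (lam : ℝ) < E then multiplicity V lam else 0 : ℕ∞) : ℝ≥0∞) ≠ ∞ :=
    fun lam => ENNReal.ne_top_of_tsum_ne_top hfin lam
  have hmem : ∀ lam : Iio (0 : ℝ), lam ∈ s ↔ (lam : ℝ) < E ∧ multiplicity V lam ≠ 0 := by
    intro lam
    rw [hsdef, Set.Finite.mem_toFinset, mem_ofPred_eq, ← ENat.toENNReal_one, ENat.toENNReal_le,
      Order.one_le_iff_ne_zero]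
    split_ifs with h <;> simp [h]
  have hfd : ∀ lam ∈ s, FiniteDimensional ℂ (eigenspace V (lam : ℝ)) := by
    intro lam hlam
    have h1 := hterm lam
    rw [if_pos ((hmem lam).1 hlam).1, ENat.toENNReal_ne_top, multiplicity, ← lt_top_iff_ne_top,
      Cardinal.toENat_lt_top, Module.rank_lt_aleph0_iff] at h1
    exact h1
  obtain ⟨h1, h2⟩ := finrank_finset_sup_le s (fun lam => eigenspace V (lam : ℝ)) hfd
  refine ⟨_, h1, ?_, ?_, ?_⟩
  · have hle : s.sup (fun lam => eigenspace V (lam : ℝ)) ≤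
        { carrier := {f | ∃ g ∈ s.sup (fun lam => eigenspace V (lam : ℝ)), IsSchrodinger V f g}
          add_mem' := by
            rintro f₁ f₂ ⟨g₁, hg₁, h₁⟩ ⟨g₂, hg₂, h₂⟩
            exact ⟨g₁ + g₂, Submodule.add_mem _ hg₁ hg₂, h₁.add hV h₂⟩
          zero_mem' := ⟨0, Submodule.zero_mem _, isSchrodinger_zero hV⟩
          smul_mem' := by
            rintro k f ⟨g, hg, h⟩
            exact ⟨k • g, Submodule.smul_mem _ _ hg, h.smul hV k⟩ } := by
      refine Finset.sup_le fun lam hlam f hf => ?_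
      exact ⟨_, Submodule.smul_mem _ _ (Finset.le_sup (f := fun lam : Iio (0 : ℝ) =>
        eigenspace V (lam : ℝ)) hlam hf), (mem_eigenspace hV).1 hf⟩
    exact fun f hf => hle hf
  · intro lam hlam
    by_cases h : multiplicity V lam = 0
    · rw [multiplicity, Cardinal.toENat_eq_zero, Submodule.rank_eq_zero] at h
      rw [h]; exact bot_le
    · have h5 : (⟨lam, hlam.trans hE⟩ : Iio (0 : ℝ)) ∈ s := (hmem _).2 ⟨hlam, h⟩
      have h6 := Finset.le_sup (f := fun lam : Iio (0 : ℝ) => eigenspace V (lam : ℝ)) h5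
      exact h6
  · have h3 : ∀ lam ∈ s, (Module.finrank ℂ (eigenspace V (lam : ℝ)) : ℝ≥0∞) =
        ((if (lam : ℝ) < E then multiplicity V lam else 0 : ℕ∞) : ℝ≥0∞) := by
      intro lam hlam
      have := hfd lam hlam
      rw [if_pos ((hmem lam).1 hlam).1, multiplicity, ← Module.finrank_eq_rank, map_natCast,
        ENat.toENNReal_coe]
    have h4 : ((∑ lam ∈ s, Module.finrank ℂ (eigenspace V (lam : ℝ)) : ℕ) : ℝ≥0∞) ≤ count V E := by
      rw [Nat.cast_sum, Finset.sum_congr rfl h3]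
      exact ENNReal.sum_le_tsum s
    refine le_trans ?_ h4
    rw [Nat.cast_le]
    exact h2

/-- If a `k`-dimensional family of functions on a disjoint union of two star graphs has energy
below `E`, there are at least `k` eigenvalues below `E` on the union. -/
theorem le_count_add_count {ι₁ ι₂ : Type} [Fintype ι₁] [Fintype ι₂] {V₁ : ι₁ → ℝ → ℝ}
    {V₂ : ι₂ → ℝ → ℝ} (hV₁ : IsPotential V₁) (hV₂ : IsPotential V₂) {E : ℝ} (hE : E < 0) {k : ℕ}
    (f₁ : Fin k → domain hV₁) (f₂ : Fin k → domain hV₂)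
    (hneg : ∀ a : Fin k → ℂ, a ≠ 0 → shiftedForm hV₁ E (∑ i, a i • f₁ i) +
      shiftedForm hV₂ E (∑ i, a i • f₂ i) < 0) :
    (k : ℝ≥0∞) ≤ count V₁ E + count V₂ E := by
  by_cases hfin₁ : count V₁ E = ∞
  · rw [hfin₁]; simp
  by_cases hfin₂ : count V₂ E = ∞
  · rw [hfin₂]; simp
  obtain ⟨F₁, hd₁, hs₁, hm₁, hc₁⟩ := exists_spectral_subspace hV₁ hE hfin₁
  obtain ⟨F₂, hd₂, hs₂, hm₂, hc₂⟩ := exists_spectral_subspace hV₂ hE hfin₂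
  refine le_trans ?_ (add_le_add hc₁ hc₂)
  rw [← Nat.cast_add, Nat.cast_le]
  by_contra! hlt
  -- If dim F₁ + dim F₂ < k, some nonzero combination projects to 0 in both spaces. Its two
  -- components then have nonnegative energy relative to E, contradicting `hneg`.
  set L : (Fin k → ℂ) →ₗ[ℂ] F₁ × F₂ :=
    (F₁.orthogonalProjectionOnto.toLinearMap ∘ₗ embed hV₁ ∘ₗ Fintype.linearCombination ℂ f₁).prod
    (F₂.orthogonalProjectionOnto.toLinearMap ∘ₗ embed hV₂ ∘ₗ Fintype.linearCombination ℂ f₂)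
    with hL
  have hker : L.ker ≠ ⊥ := LinearMap.ker_ne_bot_of_finrank_lt (by
    rw [Module.finrank_prod, Module.finrank_fin_fun]; exact hlt)
  obtain ⟨a, ha, ha0⟩ := (Submodule.ne_bot_iff _).1 hker
  rw [LinearMap.mem_ker] at ha
  have ha₁ : embed hV₁ (∑ i, a i • f₁ i) ∈ F₁ᗮ := by
    rw [← Submodule.orthogonalProjectionOnto_eq_zero_iff]
    exact congrArg Prod.fst ha
  have ha₂ : embed hV₂ (∑ i, a i • f₂ i) ∈ F₂ᗮ := by
    rw [← Submodule.orthogonalProjectionOnto_eq_zero_iff]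
    exact congrArg Prod.snd ha
  have h1 := shiftedForm_nonneg_of_orthogonal hV₁ F₁ hs₁ hE hm₁ _ ha₁
  have h2 := shiftedForm_nonneg_of_orthogonal hV₂ F₂ hs₂ hE hm₂ _ ha₂
  linarith [hneg a ha0]

theorem isOrtho_eigenspace (hV : IsPotential V) {lam mu : ℝ} (h : lam ≠ mu) :
    eigenspace V lam ⟂ eigenspace V mu := by
  rw [Submodule.isOrtho_iff_inner_eq]
  intro u hu v hv
  obtain ⟨p, rfl, hp⟩ := (isSchrodinger_iff hV).1 ((mem_eigenspace hV).1 hu)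
  obtain ⟨q, rfl, hq⟩ := (isSchrodinger_iff hV).1 ((mem_eigenspace hV).1 hv)
  have h1 := hq p
  have h2 := congrArg conj (hp q)
  rw [conj_sesqForm, inner_conj_symm, h1, inner_smul_right, inner_smul_left,
    Complex.conj_ofReal] at h2
  have h3 : ((mu : ℂ) - lam) * inner ℂ (embed hV p) (embed hV q) = 0 := by
    linear_combination h2
  rcases mul_eq_zero.1 h3 with h4 | h4
  · rw [sub_eq_zero] at h4
    exact absurd (Complex.ofReal_injective h4).symm h
  · exact h4

/-- Eigenvalue counts are witnessed by orthonormal families of eigenfunctions. -/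
theorem exists_orthonormal_of_le_count (hV : IsPotential V) {E : ℝ} {k : ℕ}
    (hk : (k : ℝ≥0∞) ≤ count V E) :
    ∃ (f : Fin k → domain hV) (mu : Fin k → ℝ), (∀ i, mu i < E) ∧
      Orthonormal ℂ (fun i => embed hV (f i)) ∧
      ∀ i q, sesqForm hV q (f i) = mu i * inner ℂ (embed hV q) (embed hV (f i)) := by
  obtain ⟨s, m, hm, hks⟩ := exists_finset_sum_of_le_tsum _ k hk
  have hLI : ∀ lam : s, ∃ v : Fin (m lam) → eigenspace V (lam : Iio (0 : ℝ)), Orthonormal ℂ v := by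
    intro lam
    have h1 : (m lam : ℕ∞) ≤ multiplicity V (lam : Iio (0 : ℝ)) := by
      refine (hm lam).trans ?_
      split_ifs
      · exact le_rfl
      · exact zero_le
    rw [multiplicity, Cardinal.natCast_le_toENat, Module.le_rank_iff] at h1
    obtain ⟨v, hv⟩ := h1
    exact ⟨_, InnerProductSpace.gramSchmidtNormed_orthonormal hv⟩
  choose v hv using hLI
  have hfam : OrthogonalFamily ℂ (fun lam : s => eigenspace V ((lam : Iio (0 : ℝ)) : ℝ))
      fun lam => (eigenspace V ((lam : Iio (0 : ℝ)) : ℝ)).subtypeₗᵢ :=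
    OrthogonalFamily.of_pairwise fun lam mu hne => isOrtho_eigenspace hV fun h =>
      hne (Subtype.ext (Subtype.ext h))
  have hon := hfam.orthonormal_sigma_orthonormal hv
  have hcard : k ≤ Fintype.card (Σ lam : s, Fin (m lam)) := by
    rw [Fintype.card_sigma]
    simp only [Fintype.card_fin]
    rwa [Finset.sum_coe_sort s m]
  obtain ⟨e⟩ : Nonempty (Fin k ↪ Σ lam : s, Fin (m lam)) :=
    Function.Embedding.nonempty_of_card_le (by simpa using hcard)
  have heig : ∀ i, ∃ p : domain hV, embed hV p = (v (e i).1 (e i).2 : StarL2 ι) ∧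
      ∀ q, sesqForm hV q p = inner ℂ (embed hV q) ((((e i).1 : Iio (0 : ℝ)) : ℝ) •
        (v (e i).1 (e i).2 : StarL2 ι)) := fun i =>
    (isSchrodinger_iff hV).1 ((mem_eigenspace hV).1 (v (e i).1 (e i).2).2)
  choose f hf hfs using heig
  refine ⟨f, fun i => (((e i).1 : Iio (0 : ℝ)) : ℝ), fun i => ?_, ?_, fun i q => ?_⟩
  · by_contra hlt
    have h1 := hm (e i).1
    rw [if_neg hlt] at h1
    have h2 : m (e i).1 = 0 := by simpa using h1
    exact (Fin.cast h2 (e i).2).elim0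
  · have h3 := hon.comp e e.injective
    convert h3 using 2 with i
    exact hf i
  · rw [hfs, hf, RCLike.real_smul_eq_coe_smul (K := ℂ), inner_smul_right]
    rfl

theorem shiftedForm_sum_smul {hV : IsPotential V} {E : ℝ} {k : ℕ} (f : Fin k → domain hV)
    (a : Fin k → ℂ) : shiftedForm hV E (∑ i, a i • f i) =
      (∑ i, ∑ j, conj (a i) * a j * shiftedSesq hV E (f i) (f j)).re := by
  rw [← re_shiftedSesq_self]
  simp only [map_sum, map_smulₛₗ, LinearMap.sum_apply, LinearMap.smul_apply, smul_eq_mul,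
    RingHom.id_apply, Finset.mul_sum]
  rw [Finset.sum_comm]
  congr 1
  refine Finset.sum_congr rfl fun i _ => Finset.sum_congr rfl fun j _ => ?_
  ring

theorem shiftedSesq_of_eigen {hV : IsPotential V} {E : ℝ} {k : ℕ} {f : Fin k → domain hV}
    {mu : Fin k → ℝ} (hf : Orthonormal ℂ (fun i => embed hV (f i)))
    (hmu : ∀ i q, sesqForm hV q (f i) = mu i * inner ℂ (embed hV q) (embed hV (f i)))
    (i j : Fin k) : shiftedSesq hV E (f i) (f j) = if i = j then ((mu i - E : ℝ) : ℂ) else 0 := by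
  rw [shiftedSesq_apply, hmu, ← sub_mul, orthonormal_iff_ite.1 hf]
  split_ifs with h
  · subst h; push_cast; ring
  · ring

end

section

/-! ### Traces as integrals of counting functions -/

/-- Layer cake: the condition on s is s < |λ|^γ, which describes an interval of length |λ|^γ. -/
theorem lintegral_ite_lt_neg_rpow {γ : ℝ} (hγ : 0 < γ) {lam : ℝ} (hlam : lam < 0) (m : ℕ∞) :
    ∫⁻ s in Ioi (0 : ℝ), ((if lam < -s ^ (1 / γ) then m else 0 : ℕ∞) : ℝ≥0∞) =
      (m : ℝ≥0∞) * ENNReal.ofReal (|lam| ^ γ) := by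
  have h1 : ∀ s ∈ Ioi (0 : ℝ), ((if lam < -s ^ (1 / γ) then m else 0 : ℕ∞) : ℝ≥0∞) =
      (Iio (|lam| ^ γ)).indicator (fun _ => (m : ℝ≥0∞)) s := by
    intro s hs
    have h2 : lam < -s ^ (1 / γ) ↔ s < |lam| ^ γ := by
      have h3 : 0 < |lam| := abs_pos.2 hlam.ne
      rw [lt_neg, ← abs_of_neg hlam, one_div]
      exact Real.rpow_inv_lt_iff_of_pos (le_of_lt hs) h3.le hγ
    by_cases h : lam < -s ^ (1 / γ)
    · rw [if_pos h, indicator_of_mem (mem_Iio.2 (h2.1 h))]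
    · rw [if_neg h, indicator_of_notMem (fun h' => h (h2.2 (mem_Iio.1 h')))]; simp
  rw [setLIntegral_congr_fun measurableSet_Ioi h1, lintegral_indicator_const measurableSet_Iio,
    Measure.restrict_apply measurableSet_Iio, inter_comm, Ioi_inter_Iio, Real.volume_Ioo, sub_zero]

theorem measurable_ite_lt_neg_rpow (γ lam : ℝ) (m : ℕ∞) :
    Measurable fun s : ℝ => ((if lam < -s ^ (1 / γ) then m else 0 : ℕ∞) : ℝ≥0∞) := by
  have h : (fun s : ℝ => ((if lam < -s ^ (1 / γ) then m else 0 : ℕ∞) : ℝ≥0∞)) =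
      fun s => if lam < -s ^ (1 / γ) then (m : ℝ≥0∞) else 0 := by
    ext s; split_ifs <;> simp
  rw [h]
  exact Measurable.ite (measurableSet_lt measurable_const (by fun_prop)) measurable_const
    measurable_const

/-- Allows counting functions to be compared through finite families only, even when a count is
infinite. -/
theorem le_of_forall_natCast_le_tsum {α : Type*} (g : α → ℕ∞) {R : ℝ≥0∞}
    (h : ∀ k : ℕ, (k : ℝ≥0∞) ≤ ∑' a, (g a : ℝ≥0∞) → (k : ℝ≥0∞) ≤ R) :
    ∑' a, (g a : ℝ≥0∞) ≤ R := by
  by_cases htop : ∑' a, (g a : ℝ≥0∞) = ∞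
  · rw [htop] at h ⊢
    have h1 : ⨆ k : ℕ, (k : ℝ≥0∞) ≤ R := iSup_le fun k => h k le_top
    rwa [ENNReal.iSup_natCast] at h1
  · have hg : ∀ a, g a ≠ ⊤ := fun a =>
      ENat.toENNReal_ne_top.1 (ENNReal.ne_top_of_tsum_ne_top htop a)
    rw [ENNReal.tsum_eq_iSup_sum]
    refine iSup_le fun s => ?_
    have h5 : ∑ a ∈ s, (g a : ℝ≥0∞) = ((∑ a ∈ s, (g a).toNat : ℕ) : ℝ≥0∞) := by
      push_cast
      refine Finset.sum_congr rfl fun a _ => ?_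
      conv_lhs => rw [← ENat.natCast_toNat (hg a)]
      simp
    rw [h5]
    refine h _ ?_
    rw [← h5]
    exact ENNReal.sum_le_tsum s

section

variable {ι : Type} [Fintype ι]

theorem traceNeg_eq_lintegral {γ : ℝ} (hγ : 0 < γ) (V : ι → ℝ → ℝ) :
    traceNeg γ V = ∫⁻ s in Ioi (0 : ℝ), count V (-s ^ (1 / γ)) := by
  have hterm : ∀ lam : Iio (0 : ℝ), (multiplicity V (lam : ℝ) : ℝ≥0∞) *
      ENNReal.ofReal (|(lam : ℝ)| ^ γ) = ∫⁻ s in Ioi (0 : ℝ),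
        ((if (lam : ℝ) < -s ^ (1 / γ) then multiplicity V lam else 0 : ℕ∞) : ℝ≥0∞) := fun lam =>
    (lintegral_ite_lt_neg_rpow hγ lam.2 _).symm
  refine le_antisymm ?_ ?_
  · rw [traceNeg, ENNReal.tsum_eq_iSup_sum]
    refine iSup_le fun s => ?_
    rw [Finset.sum_congr rfl fun lam _ => hterm lam,
      ← lintegral_finsetSum _ fun lam _ => measurable_ite_lt_neg_rpow γ _ _]
    exact lintegral_mono fun _ => ENNReal.sum_le_tsum s
  · by_cases htop : traceNeg γ V = ∞
    · rw [htop]; exact le_top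
    set T := Function.support fun lam : Iio (0 : ℝ) => (multiplicity V (lam : ℝ) : ℝ≥0∞) *
      ENNReal.ofReal (|(lam : ℝ)| ^ γ) with hT
    -- Exchanging sum and integral requires a countable index set. A finite trace has countable
    -- support, and the remaining levels have multiplicity 0.
    have hcount : T.Countable := Summable.countable_support_ennreal htop
    have hzero : ∀ lam : Iio (0 : ℝ), lam ∉ T → multiplicity V (lam : ℝ) = 0 := by
      intro lam hlam
      rw [hT, Function.notMem_support, mul_eq_zero, ENat.toENNReal_eq_zero,
        ENNReal.ofReal_eq_zero] at hlam
      exact hlam.resolve_right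
        (not_le.2 (Real.rpow_pos_of_pos (abs_pos.2 (ne_of_lt lam.2)) _))
    have hsub : ∀ E, count V E = ∑' lam : T,
        ((if ((lam : Iio (0 : ℝ)) : ℝ) < E then multiplicity V (lam : Iio (0 : ℝ)) else 0 : ℕ∞) :
          ℝ≥0∞) := by
      intro E
      refine (tsum_subtype_eq_of_support_subset (f := fun lam : Iio (0 : ℝ) =>
        ((if (lam : ℝ) < E then multiplicity V lam else 0 : ℕ∞) : ℝ≥0∞)) ?_).symm
      intro lam hlam
      by_contra hnot
      refine hlam ?_
      simp [hzero lam hnot]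
    have := hcount.to_subtype
    simp only [hsub]
    rw [lintegral_tsum fun lam => (measurable_ite_lt_neg_rpow γ _ _).aemeasurable]
    simp only [← hterm]
    exact ENNReal.tsum_comp_le_tsum_of_injective Subtype.val_injective _

theorem measurable_count_neg_rpow (V : ι → ℝ → ℝ) (γ : ℝ) :
    Measurable fun s : ℝ => count V (-s ^ (1 / γ)) :=
  (count_mono V).measurable.comp (by fun_prop)

/-! ### Decoupling -/

/-- The contribution of one edge to the quadratic form of `H - lam`. -/
def edgeForm (w : ℝ → ℝ) (lam : ℝ) (u u' : HalfLineL2) : ℝ :=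
  ‖u'‖ ^ 2 + (∫ x in Ioi (0 : ℝ), w x * ‖u x‖ ^ 2) - lam * ‖u‖ ^ 2

theorem shiftedForm_eq_sum {V : ι → ℝ → ℝ} {hV : IsPotential V} {lam : ℝ} (p : domain hV) :
    shiftedForm hV lam p = ∑ i, edgeForm (V i) lam (p.1.1 i) (p.1.2 i) := by
  rw [shiftedForm, re_sesqForm_self, embed_apply, PiLp.norm_sq_eq_of_L2, PiLp.norm_sq_eq_of_L2]
  simp only [edgeForm, Finset.sum_sub_distrib, Finset.sum_add_distrib, Finset.mul_sum]

theorem IsPotential.comp {ι κ : Type} {V : ι → ℝ → ℝ} (hV : IsPotential V) (e : κ → ι) :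
    IsPotential (V ∘ e) where
  posPart_loc i := hV.posPart_loc (e i)
  negPart_memLp := by
    obtain ⟨p, h1, h2, h3⟩ := hV.negPart_memLp
    exact ⟨p, h1, h2, fun i => h3 (e i)⟩

/-- Restriction of functions in the form domain to some of the edges. -/
def restrictEdges {κ : Type} [Fintype κ] {V : ι → ℝ → ℝ} (hV : IsPotential V) (e : κ → ι) :
    domain hV →ₗ[ℂ] domain (hV.comp e) where
  toFun p := ⟨(WithLp.toLp 2 fun i => p.1.1 (e i), WithLp.toLp 2 fun i => p.1.2 (e i)), by
    obtain ⟨⟨c, hc⟩, hp⟩ := p.2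
    exact ⟨⟨c, fun i => hc (e i)⟩, fun i => hp (e i)⟩⟩
  map_add' _ _ := rfl
  map_smul' _ _ := rfl

/-- Restricting eigenfunctions to the two groups of edges preserves the total energy, while the two
parts are no longer tied together at the vertex. -/
theorem count_le_count_add_count {κ₁ κ₂ : Type} [Fintype κ₁] [Fintype κ₂] {V : ι → ℝ → ℝ}
    (hV : IsPotential V) (e : κ₁ ⊕ κ₂ ≃ ι) {E : ℝ} (hE : E < 0) :
    count V E ≤ count (V ∘ e ∘ Sum.inl) E + count (V ∘ e ∘ Sum.inr) E := by
  refine le_of_forall_natCast_le_tsum _ fun k hk => ?_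
  obtain ⟨f, mu, hmuE, hon, hmu⟩ := exists_orthonormal_of_le_count hV hk
  refine le_count_add_count (hV.comp (e ∘ Sum.inl)) (hV.comp (e ∘ Sum.inr)) hE
    (fun i => restrictEdges hV (e ∘ Sum.inl) (f i)) (fun i => restrictEdges hV (e ∘ Sum.inr) (f i))
    fun a ha => ?_
  simp only [← map_smul, ← map_sum]
  have hsplit : ∀ p : domain hV, shiftedForm (hV.comp (e ∘ Sum.inl)) E
      (restrictEdges hV (e ∘ Sum.inl) p) + shiftedForm (hV.comp (e ∘ Sum.inr)) E
      (restrictEdges hV (e ∘ Sum.inr) p) = shiftedForm hV E p := by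
    intro p
    rw [shiftedForm_eq_sum, shiftedForm_eq_sum, shiftedForm_eq_sum, ← e.sum_comp,
      Fintype.sum_sum_type]
    rfl
  rw [hsplit, shiftedForm_sum_smul]
  simp only [shiftedSesq_of_eigen hon hmu, mul_ite, mul_zero, Finset.sum_ite_eq, Finset.mem_univ,
    if_true, Complex.conj_mul', Complex.re_sum]
  obtain ⟨i, hi⟩ := Function.ne_iff.1 ha
  have hre : ∀ i, (((‖a i‖ : ℂ) ^ 2 * ((mu i - E : ℝ) : ℂ)).re) = ‖a i‖ ^ 2 * (mu i - E) := by
    intro i; norm_cast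
  simp only [hre]
  refine Finset.sum_neg' (fun j _ => ?_) ⟨i, Finset.mem_univ i, ?_⟩
  · nlinarith [sq_nonneg ‖a j‖, hmuE j]
  · have : 0 < ‖a i‖ ^ 2 := by
      have : 0 < ‖a i‖ := norm_pos_iff.2 hi
      positivity
    nlinarith [hmuE i]

theorem traceNeg_le_traceNeg_add_traceNeg {κ₁ κ₂ : Type} [Fintype κ₁] [Fintype κ₂]
    {V : ι → ℝ → ℝ} (hV : IsPotential V) (e : κ₁ ⊕ κ₂ ≃ ι) {γ : ℝ} (hγ : 0 < γ) :
    traceNeg γ V ≤ traceNeg γ (V ∘ e ∘ Sum.inl) + traceNeg γ (V ∘ e ∘ Sum.inr) := by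
  rw [traceNeg_eq_lintegral hγ, traceNeg_eq_lintegral hγ, traceNeg_eq_lintegral hγ,
    ← lintegral_add_left (measurable_count_neg_rpow _ _)]
  refine setLIntegral_mono' measurableSet_Ioi fun s hs => ?_
  exact count_le_count_add_count hV e (neg_lt_zero.2 (Real.rpow_pos_of_pos hs _))

theorem negIntegral_eq_add {κ₁ κ₂ : Type} [Fintype κ₁] [Fintype κ₂] (V : ι → ℝ → ℝ)
    (e : κ₁ ⊕ κ₂ ≃ ι) (γ : ℝ) :
    negIntegral γ V = negIntegral γ (V ∘ e ∘ Sum.inl) + negIntegral γ (V ∘ e ∘ Sum.inr) := by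
  rw [negIntegral, ← e.sum_comp, Fintype.sum_sum_type]
  rfl

theorem count_eq_zero_of_nonneg {V : ι → ℝ → ℝ} (hV : IsPotential V)
    (hnonneg : ∀ i, ∀ᵐ x ∂halfLineMeasure, 0 ≤ V i x) {E : ℝ} (hE : E < 0) : count V E = 0 := by
  refine le_antisymm (le_of_forall_natCast_le_tsum _ fun k hk => ?_) zero_le
  obtain ⟨f, mu, hmuE, hon, hmu⟩ := exists_orthonormal_of_le_count hV hk
  rcases Nat.eq_zero_or_pos k with rfl | hpos
  · simp
  have h1 := congrArg Complex.re (hmu ⟨0, hpos⟩ (f ⟨0, hpos⟩))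
  have h2 : (inner ℂ (embed hV (f ⟨0, hpos⟩)) (embed hV (f ⟨0, hpos⟩)) : ℂ) = 1 := by
    have := orthonormal_iff_ite.1 hon ⟨0, hpos⟩ ⟨0, hpos⟩
    rwa [if_pos rfl] at this
  rw [h2, mul_one, Complex.ofReal_re, re_sesqForm_self] at h1
  have h3 : 0 ≤ ∑ i, ∫ x in Ioi (0 : ℝ), V i x * ‖(f ⟨0, hpos⟩).1.1 i x‖ ^ 2 :=
    Finset.sum_nonneg fun i _ => integral_nonneg_of_ae (by
      filter_upwards [hnonneg i] with x hx
      exact mul_nonneg hx (sq_nonneg _))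
  have h4 := hmuE ⟨0, hpos⟩
  have h5 := sq_nonneg ‖(f ⟨0, hpos⟩).1.2‖
  linarith

theorem traceNeg_eq_zero {V : ι → ℝ → ℝ} (hV : IsPotential V) {γ : ℝ} (hγ : 0 < γ)
    (h : negIntegral γ V = 0) : traceNeg γ V = 0 := by
  have hnonneg : ∀ i, ∀ᵐ x ∂halfLineMeasure, 0 ≤ V i x := by
    intro i
    rw [negIntegral, Finset.sum_eq_zero_iff] at h
    have h1 := h i (Finset.mem_univ i)
    obtain ⟨p, -, -, h2⟩ := hV.negPart_memLp
    rw [lintegral_eq_zero_iff' ((h2 i).aestronglyMeasurable.aemeasurable.pow_const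
      _).ennreal_ofReal] at h1
    filter_upwards [h1] with x hx
    rw [Pi.zero_apply, ENNReal.ofReal_eq_zero] at hx
    by_contra! hneg
    have h3 : 0 < (V i x)⁻ := negPart_pos_iff.2 hneg
    exact absurd hx (not_le.2 (Real.rpow_pos_of_pos h3 _))
  rw [traceNeg_eq_lintegral hγ, setLIntegral_congr_fun measurableSet_Ioi fun s hs =>
    count_eq_zero_of_nonneg hV hnonneg (neg_lt_zero.2 (Real.rpow_pos_of_pos hs _))]
  simp

end

/-! ### Optimal constants -/

theorem negIntegral_comp_ne_top {ι κ : Type} [Fintype ι] [Fintype κ] {γ : ℝ} {V : ι → ℝ → ℝ}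
    (h : negIntegral γ V ≠ ∞) (e : κ → ι) : negIntegral γ (V ∘ e) ≠ ∞ := by
  rw [negIntegral, ENNReal.sum_ne_top] at h ⊢
  exact fun i _ => h (e i) (Finset.mem_univ _)

/-- The infimum is attained. A vanishing integral is treated apart: it excludes division, and there
∞ · 0 = 0 would have to bound the trace. -/
theorem traceNeg_le_optConst_mul {γ : ℝ} (hγ : 0 < γ) {N : ℕ} {V : Fin N → ℝ → ℝ}
    (hV : IsPotential V) (hI : negIntegral γ V ≠ ∞) :
    traceNeg γ V ≤ optConst γ N * negIntegral γ V := by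
  by_cases h0 : negIntegral γ V = 0
  · rw [traceNeg_eq_zero hV hγ h0]; exact zero_le
  · rw [← ENNReal.div_le_iff h0 hI, optConst]
    refine le_sInf fun L hL => ?_
    rw [ENNReal.div_le_iff h0 hI]
    exact hL V hV hI

theorem traceNeg_le_optConst_add {γ : ℝ} (hγ : 0 < γ) {M K N : ℕ} (e : Fin M ⊕ Fin K ≃ Fin N)
    {V : Fin N → ℝ → ℝ} (hV : IsPotential V) (hI : negIntegral γ V ≠ ∞) :
    traceNeg γ V ≤ optConst γ M * negIntegral γ (V ∘ e ∘ Sum.inl) +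
      optConst γ K * negIntegral γ (V ∘ e ∘ Sum.inr) :=
  (traceNeg_le_traceNeg_add_traceNeg hV e hγ).trans (add_le_add
    (traceNeg_le_optConst_mul hγ (hV.comp (e ∘ Sum.inl)) (negIntegral_comp_ne_top hI _))
    (traceNeg_le_optConst_mul hγ (hV.comp (e ∘ Sum.inr)) (negIntegral_comp_ne_top hI _)))

theorem optConst_two_mul_le {γ : ℝ} (hγ : 0 < γ) (m : ℕ) : optConst γ (2 * m) ≤ lineConst γ := by
  induction m with
  | zero =>
    refine sInf_le fun V hV _ => ?_
    rw [traceNeg_eq_zero hV hγ (by simp [negIntegral])]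
    exact zero_le
  | succ m ih =>
    refine sInf_le fun V hV hI => ?_
    set e : Fin 2 ⊕ Fin (2 * m) ≃ Fin (2 * (m + 1)) :=
      finSumFinEquiv.trans (finCongr (by ring)) with he
    rw [negIntegral_eq_add V e, mul_add (lineConst γ)]
    exact (traceNeg_le_optConst_add hγ e hV hI).trans (add_le_add le_rfl (mul_le_mul_left ih _))

/-- For fixed i, the edge j i + k runs through every edge exactly once as k varies. -/
theorem sum_negIntegral_rotate {γ : ℝ} {M N : ℕ} [NeZero N] (V : Fin N → ℝ → ℝ)
    (j : Fin M → Fin N) :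
    ∑ k : Fin N, negIntegral γ (V ∘ fun i => j i + k) = M * negIntegral γ V := by
  simp only [negIntegral, Function.comp]
  rw [Finset.sum_comm]
  have h : ∀ i : Fin M, ∑ k : Fin N, ∫⁻ x in Ioi (0 : ℝ),
      ENNReal.ofReal ((V (j i + k) x)⁻ ^ (γ + 1 / 2)) =
      ∑ k : Fin N, ∫⁻ x in Ioi (0 : ℝ), ENNReal.ofReal ((V k x)⁻ ^ (γ + 1 / 2)) := fun i =>
    Equiv.sum_comp (Equiv.addLeft (j i)) fun k => ∫⁻ x in Ioi (0 : ℝ),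
      ENNReal.ofReal ((V k x)⁻ ^ (γ + 1 / 2))
  simp only [h, Finset.sum_const, Finset.card_univ, Fintype.card_fin, nsmul_eq_mul]

theorem natCast_mul_ofReal_div {M N : ℕ} (hN : N ≠ 0) (x : ℝ≥0∞) :
    (N : ℝ≥0∞) * (ENNReal.ofReal ((M : ℝ) / N) * x) = M * x := by
  rw [← mul_assoc, ← ENNReal.ofReal_natCast N, ← ENNReal.ofReal_mul (by positivity),
    mul_div_cancel₀ _ (by exact_mod_cast hN), ENNReal.ofReal_natCast]

theorem optConst_le_convex_combination {γ : ℝ} (hγ : 0 < γ) {N₀ N : ℕ} (h₀ : Odd N₀) (h : Odd N)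
    (hlt : N₀ < N) :
    optConst γ N ≤ ENNReal.ofReal (((N : ℝ) - (N₀ : ℝ)) / (N : ℝ)) * lineConst γ +
      ENNReal.ofReal ((N₀ : ℝ) / (N : ℝ)) * optConst γ N₀ := by
  obtain ⟨m, hm⟩ : ∃ m, N = N₀ + 2 * m := by
    obtain ⟨a, rfl⟩ := h₀
    obtain ⟨b, rfl⟩ := h
    exact ⟨b - a, by omega⟩
  have hN : N ≠ 0 := by omega
  have : NeZero N := ⟨hN⟩
  have hsub : (N : ℝ) - N₀ = ((2 * m : ℕ) : ℝ) := by rw [hm]; push_cast; ring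
  rw [hsub]
  refine sInf_le fun V hV hI => ?_
  set e₀ : Fin N₀ ⊕ Fin (2 * m) ≃ Fin N := finSumFinEquiv.trans (finCongr hm.symm) with he₀
  have hk : ∀ k : Fin N, traceNeg γ V ≤
      optConst γ N₀ * negIntegral γ (V ∘ fun i => e₀ (Sum.inl i) + k) +
      lineConst γ * negIntegral γ (V ∘ fun i => e₀ (Sum.inr i) + k) := fun k =>
    (traceNeg_le_optConst_add hγ (e₀.trans (Equiv.addRight k)) hV hI).trans
      (add_le_add le_rfl (mul_le_mul_left (optConst_two_mul_le hγ m) _))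
  have hsum := Finset.sum_le_sum fun k (_ : k ∈ Finset.univ) => hk k
  rw [Finset.sum_const, Finset.card_univ, Fintype.card_fin, nsmul_eq_mul, Finset.sum_add_distrib,
    ← Finset.mul_sum, ← Finset.mul_sum, sum_negIntegral_rotate V fun i => e₀ (Sum.inl i),
    sum_negIntegral_rotate V fun i => e₀ (Sum.inr i)] at hsum
  -- The N rotated inequalities are summed rather than averaged, so the claim is multiplied by N.
  rw [← ENNReal.mul_le_mul_iff_right (Nat.cast_ne_zero.2 hN) (ENNReal.natCast_ne_top N)]
  refine hsum.trans (le_of_eq ?_)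
  rw [add_mul, mul_add, mul_assoc, mul_assoc, natCast_mul_ofReal_div hN, natCast_mul_ofReal_div hN]
  ring

end

section

/-! ### Moving the vertex of the line -/

/-- The function on the half-line obtained from a function on the line, given by its restrictions
`f` and `g` to the two edges, by moving the origin to the point `R` of the second edge. -/
def glue {α : Type*} (R : ℝ) (f g : ℝ → α) (x : ℝ) : α := if x < R then g (R - x) else f (x - R)

theorem glue_of_lt {α : Type*} {R : ℝ} (f g : ℝ → α) {x : ℝ} (h : x < R) :
    glue R f g x = g (R - x) := if_pos h

theorem glue_of_le {α : Type*} {R : ℝ} (f g : ℝ → α) {x : ℝ} (h : R ≤ x) :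
    glue R f g x = f (x - R) := if_neg (not_lt.2 h)

theorem measurePreserving_reflect (R : ℝ) : MeasurePreserving (fun x : ℝ => R - x)
    (volume.restrict (Ioo 0 R)) (volume.restrict (Ioo 0 R)) := by
  have h := (Measure.measurePreserving_sub_left (volume : Measure ℝ) R).restrict_preimage
    (measurableSet_Ioo (a := 0) (b := R))
  have h2 : (fun x : ℝ => R - x) ⁻¹' Ioo 0 R = Ioo 0 R := by
    ext x; simp only [mem_preimage, mem_Ioo]; constructor <;> rintro ⟨h1, h2⟩ <;>
      constructor <;> linarith
  rwa [h2] at h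

theorem measurePreserving_translate_sub (R : ℝ) : MeasurePreserving (fun x : ℝ => x - R)
    (volume.restrict (Ici R)) halfLineMeasure := by
  have h := (measurePreserving_sub_right (volume : Measure ℝ) R).restrict_preimage
    (measurableSet_Ici (a := 0))
  have h2 : (fun x : ℝ => x - R) ⁻¹' Ici 0 = Ici R := by
    ext x; simp
  rw [h2] at h
  rwa [halfLineMeasure, restrict_Ioi_eq_restrict_Ici]

theorem measurePreserving_translate_add (R : ℝ) : MeasurePreserving (fun x : ℝ => R + x)
    halfLineMeasure (volume.restrict (Ioi R)) := by
  have h := (measurePreserving_add_left (volume : Measure ℝ) R).restrict_preimage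
    (measurableSet_Ioi (a := R))
  have h2 : (fun x : ℝ => R + x) ⁻¹' Ioi R = Ioi 0 := by
    ext x; simp
  rwa [h2] at h

theorem halfLineMeasure_eq_add {R : ℝ} (hR : 0 < R) :
    halfLineMeasure = volume.restrict (Ioo 0 R) + volume.restrict (Ici R) := by
  rw [← Measure.restrict_union (by
    rw [Set.disjoint_left]; intro x hx hx'; exact not_lt.2 hx' hx.2) measurableSet_Ici,
    Ioo_union_Ici_eq_Ioi hR]

theorem measurableEmbedding_reflect (R : ℝ) : MeasurableEmbedding fun x : ℝ => R - x :=
  (Homeomorph.subLeft R).measurableEmbedding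

theorem measurableEmbedding_translate_sub (R : ℝ) : MeasurableEmbedding fun x : ℝ => x - R :=
  (Homeomorph.subRight R).measurableEmbedding

theorem measurableEmbedding_translate_add (R : ℝ) : MeasurableEmbedding fun x : ℝ => R + x :=
  (Homeomorph.addLeft R).measurableEmbedding

theorem restrict_Ioo_le_halfLineMeasure (R : ℝ) : volume.restrict (Ioo 0 R) ≤ halfLineMeasure :=
  Measure.restrict_mono (fun _ hx => hx.1) le_rfl

theorem restrict_Ioi_le_halfLineMeasure {R : ℝ} (hR : 0 < R) :
    volume.restrict (Ioi R) ≤ halfLineMeasure :=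
  Measure.restrict_mono (fun _ hx => hR.trans hx) le_rfl

/-- `glue` acts here on predicates, so a.e. statements on the two edges of the line move together to
the new edge. -/
theorem ae_glue {R : ℝ} (hR : 0 < R) {p q : ℝ → Prop} (hp : ∀ᵐ x ∂halfLineMeasure, p x)
    (hq : ∀ᵐ x ∂halfLineMeasure, q x) : ∀ᵐ x ∂halfLineMeasure, glue R p q x := by
  rw [halfLineMeasure_eq_add hR, ae_add_measure_iff]
  constructor
  · have h := (measurePreserving_reflect R).quasiMeasurePreserving.ae
      (ae_mono (restrict_Ioo_le_halfLineMeasure R) hq)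
    filter_upwards [h, ae_restrict_mem measurableSet_Ioo] with x hx hmem
    rwa [glue_of_lt _ _ hmem.2]
  · have h := (measurePreserving_translate_sub R).quasiMeasurePreserving.ae hp
    filter_upwards [h, ae_restrict_mem measurableSet_Ici] with x hx hmem
    rwa [glue_of_le _ _ hmem]

theorem ae_translate {R : ℝ} (hR : 0 < R) {q : ℝ → Prop} (hq : ∀ᵐ x ∂halfLineMeasure, q x) :
    ∀ᵐ x ∂halfLineMeasure, q (R + x) :=
  (measurePreserving_translate_add R).quasiMeasurePreserving.ae
    (ae_mono (restrict_Ioi_le_halfLineMeasure hR) hq)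

theorem memLp_glue {E : Type*} [NormedAddCommGroup E] {p : ℝ≥0∞} {R : ℝ} {f g : ℝ → E}
    (hf : MemLp f p halfLineMeasure) (hg : MemLp g p halfLineMeasure) :
    MemLp (glue R f g) p halfLineMeasure := by
  have h1 : MemLp ((Ioo 0 R).indicator (g ∘ fun x => R - x)) p halfLineMeasure := by
    rw [memLp_indicator_iff_restrict measurableSet_Ioo, Measure.restrict_restrict measurableSet_Ioo,
      inter_eq_left.2 fun x hx => hx.1]
    exact (hg.mono_measure (restrict_Ioo_le_halfLineMeasure R)).comp_measurePreserving
      (measurePreserving_reflect R)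
  have h2 : MemLp ((Ici R).indicator (f ∘ fun x => x - R)) p halfLineMeasure := by
    rw [memLp_indicator_iff_restrict measurableSet_Ici, Measure.restrict_restrict measurableSet_Ici]
    exact (hf.comp_measurePreserving (measurePreserving_translate_sub R)).mono_measure
      (Measure.restrict_mono inter_subset_left le_rfl)
  refine (h1.add h2).ae_eq ?_
  filter_upwards [ae_restrict_mem measurableSet_Ioi] with x hx
  rcases lt_or_ge x R with h | h
  · have h3 : x ∈ Ioo 0 R := ⟨hx, h⟩
    simp [glue_of_lt _ _ h, h3, h]
  · have h3 : x ∉ Ioo 0 R := fun h' => not_lt.2 h h'.2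
    simp [glue_of_le _ _ h, h3, h]

theorem memLp_translate {E : Type*} [NormedAddCommGroup E] {p : ℝ≥0∞} {R : ℝ} (hR : 0 < R)
    {g : ℝ → E} (hg : MemLp g p halfLineMeasure) :
    MemLp (fun x => g (R + x)) p halfLineMeasure :=
  (hg.mono_measure (restrict_Ioi_le_halfLineMeasure hR)).comp_measurePreserving
    (measurePreserving_translate_add R)

theorem integrable_glue {E : Type*} [NormedAddCommGroup E] {R : ℝ} {f g : ℝ → E}
    (hf : Integrable f halfLineMeasure) (hg : Integrable g halfLineMeasure) :
    Integrable (glue R f g) halfLineMeasure := by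
  rw [← memLp_one_iff_integrable] at *
  exact memLp_glue hf hg

theorem integrable_translate {E : Type*} [NormedAddCommGroup E] {R : ℝ} (hR : 0 < R)
    {g : ℝ → E} (hg : Integrable g halfLineMeasure) :
    Integrable (fun x => g (R + x)) halfLineMeasure := by
  rw [← memLp_one_iff_integrable] at *
  exact memLp_translate hR hg

theorem integral_glue {E : Type*} [NormedAddCommGroup E] [NormedSpace ℝ E] {R : ℝ} (hR : 0 < R)
    {f g : ℝ → E} (hf : Integrable f halfLineMeasure) (hg : Integrable g halfLineMeasure) :
    ∫ x in Ioi (0 : ℝ), glue R f g x = (∫ x in Ioi (0 : ℝ), f x) + ∫ x in Ioo 0 R, g x := by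
  have hint := integrable_glue (R := R) hf hg
  have h1 : ∫ x in Ioo 0 R, glue R f g x = ∫ x in Ioo 0 R, g x := by
    rw [← (measurePreserving_reflect R).integral_comp (measurableEmbedding_reflect R) g]
    exact setIntegral_congr_fun measurableSet_Ioo fun x hx => glue_of_lt _ _ hx.2
  have h2 : ∫ x in Ici R, glue R f g x = ∫ x in Ioi (0 : ℝ), f x := by
    rw [← (measurePreserving_translate_sub R).integral_comp (measurableEmbedding_translate_sub R) f]
    exact setIntegral_congr_fun measurableSet_Ici fun x hx => glue_of_le _ _ hx
  rw [halfLineMeasure_eq_add hR, integrable_add_measure] at hint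
  change ∫ x, glue R f g x ∂halfLineMeasure = _
  rw [halfLineMeasure_eq_add hR, integral_add_measure hint.1 hint.2, h1, h2, add_comm]

theorem integral_translate {E : Type*} [NormedAddCommGroup E] [NormedSpace ℝ E] (R : ℝ)
    (g : ℝ → E) : ∫ x in Ioi (0 : ℝ), g (R + x) = ∫ x in Ioi R, g x :=
  (measurePreserving_translate_add R).integral_comp (measurableEmbedding_translate_add R) g

theorem lintegral_glue {R : ℝ} (hR : 0 < R) (f g : ℝ → ℝ≥0∞) :
    ∫⁻ x in Ioi (0 : ℝ), glue R f g x = (∫⁻ x in Ioi (0 : ℝ), f x) + ∫⁻ x in Ioo 0 R, g x := by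
  have h1 : ∫⁻ x in Ioo 0 R, glue R f g x = ∫⁻ x in Ioo 0 R, g x := by
    rw [← (measurePreserving_reflect R).lintegral_comp_emb (measurableEmbedding_reflect R) g]
    exact setLIntegral_congr_fun measurableSet_Ioo fun x hx => glue_of_lt _ _ hx.2
  have h2 : ∫⁻ x in Ici R, glue R f g x = ∫⁻ x in Ioi (0 : ℝ), f x := by
    rw [← (measurePreserving_translate_sub R).lintegral_comp_emb
      (measurableEmbedding_translate_sub R) f]
    exact setLIntegral_congr_fun measurableSet_Ici fun x hx => glue_of_le _ _ hx
  change ∫⁻ x, glue R f g x ∂halfLineMeasure = _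
  rw [halfLineMeasure_eq_add hR, lintegral_add_measure, h1, h2, add_comm]

theorem lintegral_translate (R : ℝ) (g : ℝ → ℝ≥0∞) :
    ∫⁻ x in Ioi (0 : ℝ), g (R + x) = ∫⁻ x in Ioi R, g x :=
  (measurePreserving_translate_add R).lintegral_comp_emb (measurableEmbedding_translate_add R) g

/-- `glue` for `L²` functions. -/
def glueL2 (R : ℝ) (u v : HalfLineL2) : HalfLineL2 :=
  (memLp_glue (R := R) (Lp.memLp u) (Lp.memLp v)).toLp _

/-- The translation of an `L²` function. -/
def translateL2 {R : ℝ} (hR : 0 < R) (v : HalfLineL2) : HalfLineL2 :=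
  (memLp_translate hR (Lp.memLp v)).toLp _

theorem coeFn_glueL2 (R : ℝ) (u v : HalfLineL2) : glueL2 R u v =ᵐ[halfLineMeasure] glue R u v :=
  MemLp.coeFn_toLp _

theorem coeFn_translateL2 {R : ℝ} (hR : 0 < R) (v : HalfLineL2) :
    translateL2 hR v =ᵐ[halfLineMeasure] fun x => v (R + x) :=
  MemLp.coeFn_toLp _

theorem intervalIntegral_congr_halfLine {f g : ℝ → ℂ} (h : f =ᵐ[halfLineMeasure] g) {a b : ℝ}
    (ha : 0 ≤ a) (hab : a ≤ b) : ∫ t in a..b, f t = ∫ t in a..b, g t := by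
  refine intervalIntegral.integral_congr_ae ?_
  filter_upwards [(ae_restrict_iff' measurableSet_Ioi).1 h] with t ht hmem
  rw [uIoc_of_le hab] at hmem
  exact ht (lt_of_le_of_lt ha hmem.1)

/-- The new edge starts at the point R of the old one, so its boundary value is `rep c v' R`, and
the reflection reverses the sign of the derivative. -/
theorem rep_glueL2_of_le {R : ℝ} (c : ℂ) (u' v' : HalfLineL2) {x : ℝ} (hx : 0 ≤ x)
    (hxR : x ≤ R) : rep (rep c v' R) (glueL2 R u' (-v')) x = rep c v' (R - x) := by
  have h1 : ∫ t in (0 : ℝ)..x, glueL2 R u' (-v') t = ∫ t in (0 : ℝ)..x, -v' (R - t) := by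
    rw [intervalIntegral_congr_halfLine (coeFn_glueL2 R u' (-v')) le_rfl hx]
    have hneg := (measurePreserving_reflect R).quasiMeasurePreserving.ae
      (ae_mono (restrict_Ioo_le_halfLineMeasure R) (Lp.coeFn_neg v'))
    refine intervalIntegral.integral_congr_ae ?_
    -- At R itself `glue` already takes the other branch.
    have hne : ∀ᵐ t : ℝ, t ≠ R := by simp [ae_iff]
    filter_upwards [(ae_restrict_iff' measurableSet_Ioo).1 hneg, hne] with t ht htR hmem
    rw [uIoc_of_le hx] at hmem
    have hlt : t < R := lt_of_le_of_ne (hmem.2.trans hxR) htR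
    rw [glue_of_lt _ _ hlt]
    exact ht ⟨hmem.1, hlt⟩
  rw [rep, h1, intervalIntegral.integral_neg, intervalIntegral.integral_comp_sub_left, sub_zero,
    ← rep_sub_rep c v' (by linarith) (by linarith)]
  ring

/-- At x = R the path passes through the old vertex, where both edges have the common value c. -/
theorem rep_glueL2_of_ge {R : ℝ} (hR : 0 < R) (c : ℂ) (u' v' : HalfLineL2) {x : ℝ}
    (hxR : R ≤ x) : rep (rep c v' R) (glueL2 R u' (-v')) x = rep c u' (x - R) := by
  have h0 := rep_glueL2_of_le c u' v' hR.le le_rfl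
  have h1 : ∫ t in R..x, glueL2 R u' (-v') t = ∫ t in R..x, u' (t - R) := by
    rw [intervalIntegral_congr_halfLine (coeFn_glueL2 R u' (-v')) hR.le hxR]
    refine intervalIntegral.integral_congr fun t ht => ?_
    rw [uIcc_of_le hxR] at ht
    exact glue_of_le _ _ ht.1
  have h2 := rep_sub_rep (rep c v' R) (glueL2 R u' (-v')) hR.le (hR.le.trans hxR)
  have h3 : rep c v' 0 = c := by simp [rep]
  rw [h0, h1, intervalIntegral.integral_comp_sub_right, sub_self, h3] at h2
  rw [show rep c u' (x - R) = c + ∫ t in (0 : ℝ)..(x - R), u' t from rfl]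
  linear_combination h2

theorem HasDerivTrace.glueL2 {R : ℝ} (hR : 0 < R) {u u' v v' : HalfLineL2} {c : ℂ}
    (hu : HasDerivTrace u u' c) (hv : HasDerivTrace v v' c) :
    HasDerivTrace (glueL2 R u v) (glueL2 R u' (-v')) (rep c v' R) := by
  filter_upwards [coeFn_glueL2 R u v, ae_glue hR hu hv, ae_restrict_mem measurableSet_Ioi]
    with x h1 h2 hx
  rw [h1]
  rcases lt_or_ge x R with h | h
  · rw [glue_of_lt _ _ h] at h2 ⊢
    exact h2.trans (rep_glueL2_of_le c u' v' (le_of_lt hx) h.le).symm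
  · rw [glue_of_le _ _ h] at h2 ⊢
    exact h2.trans (rep_glueL2_of_ge hR c u' v' h).symm

theorem HasDerivTrace.translateL2 {R : ℝ} (hR : 0 < R) {v v' : HalfLineL2} {c : ℂ}
    (hv : HasDerivTrace v v' c) :
    HasDerivTrace (translateL2 hR v) (translateL2 hR v') (rep c v' R) := by
  filter_upwards [coeFn_translateL2 hR v, ae_translate hR hv, ae_restrict_mem measurableSet_Ioi]
    with x h1 h2 hx
  have hx0 : (0 : ℝ) < x := hx
  have h3 : v (R + x) = rep c v' (R + x) := h2
  rw [h1, h3, intervalIntegral_congr_halfLine (coeFn_translateL2 hR v') le_rfl hx0.le,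
    intervalIntegral.integral_comp_add_left, add_zero, ← rep_sub_rep c v' hR.le (by linarith)]
  ring

/-- The potential on a star graph that, on the edge `k₀`, is obtained from the potential `V` on the
line by moving the origin far away, and is the remaining part of `V` on all the other edges. -/
def graftPotential {κ : Type} [DecidableEq κ] (k₀ : κ) (R : ℝ) (V : Fin 2 → ℝ → ℝ) (i : κ) (x : ℝ) :
    ℝ :=
  if i = k₀ then glue R (V 0) (V 1) x else V 1 (R + x)

theorem glue_comp {α β : Type*} (φ : α → β) (R : ℝ) (f g : ℝ → α) (x : ℝ) :
    φ (glue R f g x) = glue R (fun t => φ (f t)) (fun t => φ (g t)) x := by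
  simp only [glue]; split_ifs <;> rfl

theorem IsPotential.graft {κ : Type} [DecidableEq κ] (k₀ : κ) {R : ℝ} (hR : 0 < R)
    {V : Fin 2 → ℝ → ℝ} (hV : IsPotential V) : IsPotential (graftPotential k₀ R V) where
  posPart_loc i S := by
    -- V₊ is only locally integrable, so it is cut off to an integrable function before gluing.
    have hind : ∀ (j : Fin 2) (T : ℝ), Integrable ((Iic T).indicator fun x => (V j x)⁺)
        halfLineMeasure := by
      intro j T
      rw [integrable_indicator_iff measurableSet_Iic, IntegrableOn,
        Measure.restrict_restrict measurableSet_Iic, inter_comm, Ioi_inter_Iic]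
      exact hV.posPart_loc j T
    by_cases hi : i = k₀
    · have h1 := integrable_glue (R := R) (hind 0 S) (hind 1 R)
      refine (IntegrableOn.mono_set h1 Ioc_subset_Ioi_self).congr_fun (fun x hx => ?_)
        measurableSet_Ioc
      simp only [graftPotential, if_pos hi]
      rcases lt_or_ge x R with h | h
      · rw [glue_of_lt _ _ h, glue_of_lt _ _ h, indicator_of_mem (by simpa using hx.1.le)]
      · rw [glue_of_le _ _ h, glue_of_le _ _ h,
          indicator_of_mem (by simp only [mem_Iic]; linarith [hx.2])]
    · have h1 := integrable_translate hR (hind 1 (R + S))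
      refine (IntegrableOn.mono_set h1 Ioc_subset_Ioi_self).congr_fun (fun x hx => ?_)
        measurableSet_Ioc
      simp only [graftPotential, if_neg hi]
      rw [indicator_of_mem (by simpa using hx.2)]
  negPart_memLp := by
    obtain ⟨p, h1, h2, h3⟩ := hV.negPart_memLp
    refine ⟨p, h1, h2, fun i => ?_⟩
    by_cases hi : i = k₀
    · simp only [graftPotential, if_pos hi, glue_comp fun y : ℝ => y⁻]
      exact memLp_glue (h3 0) (h3 1)
    · simp only [graftPotential, if_neg hi]
      exact memLp_translate hR (h3 1)

end

/-! ### Transplanting functions from the line to a star, and the limit of a distant vertex -/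

section

/-- The density of the sesquilinear form of `H - lam` on one edge. -/
def edgeDensity (w : ℝ → ℝ) (lam : ℝ) (u u' v v' : ℝ → ℂ) (x : ℝ) : ℂ :=
  conj (u' x) * v' x + ((w x : ℂ) * conj (u x) * v x - lam * (conj (u x) * v x))

theorem integrable_conj_mul (u v : HalfLineL2) :
    Integrable (fun x => conj (u x) * v x) halfLineMeasure := by
  have h := L2.integrable_inner (𝕜 := ℂ) u v
  simpa only [RCLike.inner_apply, mul_comm] using h

theorem inner_eq_integral (u v : HalfLineL2) :
    inner ℂ u v = ∫ x in Ioi (0 : ℝ), conj (u x) * v x := by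
  rw [L2.inner_def]
  simp only [RCLike.inner_apply, mul_comm]

theorem integrable_edgeDensity {ι : Type} [Fintype ι] {V : ι → ℝ → ℝ} {hV : IsPotential V}
    (lam : ℝ) (p q : domain hV) (i : ι) :
    Integrable (edgeDensity (V i) lam (p.1.1 i) (p.1.2 i) (q.1.1 i) (q.1.2 i)) halfLineMeasure :=
  (integrable_conj_mul _ _).add
    ((integrable_potential_mul p q i).sub ((integrable_conj_mul _ _).const_mul _))

theorem shiftedSesq_eq_sum {ι : Type} [Fintype ι] {V : ι → ℝ → ℝ} {hV : IsPotential V}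
    (lam : ℝ) (p q : domain hV) :
    shiftedSesq hV lam p q = ∑ i, ∫ x in Ioi (0 : ℝ),
      edgeDensity (V i) lam (p.1.1 i) (p.1.2 i) (q.1.1 i) (q.1.2 i) x := by
  have h : ∀ i, ∫ x in Ioi (0 : ℝ),
      edgeDensity (V i) lam (p.1.1 i) (p.1.2 i) (q.1.1 i) (q.1.2 i) x =
      inner ℂ (p.1.2 i) (q.1.2 i) + ((∫ x in Ioi (0 : ℝ),
        (V i x : ℂ) * conj (p.1.1 i x) * q.1.1 i x) - lam * inner ℂ (p.1.1 i) (q.1.1 i)) := by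
    intro i
    have hs : Integrable (fun x => (V i x : ℂ) * conj (p.1.1 i x) * q.1.1 i x -
        lam * (conj (p.1.1 i x) * q.1.1 i x)) halfLineMeasure :=
      (integrable_potential_mul p q i).sub ((integrable_conj_mul _ _).const_mul _)
    rw [inner_eq_integral, inner_eq_integral, ← integral_const_mul,
      ← integral_sub (integrable_potential_mul p q i) ((integrable_conj_mul _ _).const_mul _),
      ← integral_add (integrable_conj_mul _ _) hs]
    rfl
  simp only [h, Finset.sum_add_distrib, Finset.sum_sub_distrib, ← Finset.mul_sum]
  rw [shiftedSesq_apply, sesqForm_apply, embed_apply, embed_apply, PiLp.inner_apply,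
    PiLp.inner_apply]
  ring

variable {κ : Type} [Fintype κ] [DecidableEq κ]

/-- The transplantation of a function on the line to a star graph. -/
def graft (k₀ : κ) {R : ℝ} (hR : 0 < R) {V : Fin 2 → ℝ → ℝ} {hV : IsPotential V} (p : domain hV) :
    domain (hV.graft k₀ hR) :=
  ⟨(WithLp.toLp 2 fun i => if i = k₀ then glueL2 R (p.1.1 0) (p.1.1 1) else
      translateL2 hR (p.1.1 1),
    WithLp.toLp 2 fun i => if i = k₀ then glueL2 R (p.1.2 0) (-p.1.2 1) else
      translateL2 hR (p.1.2 1)), by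
    obtain ⟨⟨c, hc⟩, hp⟩ := p.2
    refine ⟨⟨rep c (p.1.2 1) R, fun i => ?_⟩, fun i => ?_⟩
    · by_cases hi : i = k₀
      · simp only [if_pos hi]
        exact (hc 0).glueL2 hR (hc 1)
      · simp only [if_neg hi]
        exact (hc 1).translateL2 hR
    · by_cases hi : i = k₀
      · simp only [if_pos hi, graftPotential]
        refine (integrable_glue (R := R) (hp 0) (hp 1)).congr ?_
        filter_upwards [coeFn_glueL2 R (p.1.1 0) (p.1.1 1)] with x hx
        rw [hx]
        simp only [glue]
        split_ifs <;> rfl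
      · simp only [if_neg hi, graftPotential]
        refine (integrable_translate hR (hp 1)).congr ?_
        filter_upwards [coeFn_translateL2 hR (p.1.1 1)] with x hx
        rw [hx]⟩

/-- The form differs from that on the line only in the number of times the tail over (R, ∞) is
counted, so the difference vanishes as R → ∞. -/
theorem shiftedSesq_graft (k₀ : κ) {R : ℝ} (hR : 0 < R) {V : Fin 2 → ℝ → ℝ} {hV : IsPotential V}
    (lam : ℝ) (p q : domain hV) :
    shiftedSesq (hV.graft k₀ hR) lam (graft k₀ hR p) (graft k₀ hR q) =
      (∫ x in Ioi (0 : ℝ), edgeDensity (V 0) lam (p.1.1 0) (p.1.2 0) (q.1.1 0) (q.1.2 0) x) +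
      (∫ x in Ioo 0 R, edgeDensity (V 1) lam (p.1.1 1) (p.1.2 1) (q.1.1 1) (q.1.2 1) x) +
      ((Fintype.card κ - 1 : ℕ) : ℂ) *
        ∫ x in Ioi R, edgeDensity (V 1) lam (p.1.1 1) (p.1.2 1) (q.1.1 1) (q.1.2 1) x := by
  rw [shiftedSesq_eq_sum, ← Finset.add_sum_erase _ _ (Finset.mem_univ k₀),
    ← integral_glue hR (integrable_edgeDensity lam p q 0) (integrable_edgeDensity lam p q 1)]
  congr 1
  · refine integral_congr_ae ?_
    filter_upwards [coeFn_glueL2 R (p.1.1 0) (p.1.1 1), coeFn_glueL2 R (q.1.1 0) (q.1.1 1),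
      coeFn_glueL2 R (p.1.2 0) (-p.1.2 1), coeFn_glueL2 R (q.1.2 0) (-q.1.2 1),
      ae_glue hR (p := fun _ => True) (Eventually.of_forall fun _ => trivial)
        ((Lp.coeFn_neg (p.1.2 1)).and (Lp.coeFn_neg (q.1.2 1)))] with x h1 h2 h3 h4 h5
    simp only [edgeDensity, graft, graftPotential, if_true, h1, h2, h3, h4]
    rcases lt_or_ge x R with h | h
    · rw [glue_of_lt _ _ h] at h5
      -- The two sign changes of the reflected derivatives cancel.
      simp only [glue_of_lt _ _ h, edgeDensity, h5.1, h5.2, Pi.neg_apply, map_neg, neg_mul_neg]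
    · simp only [glue_of_le _ _ h, edgeDensity]
  · rw [← integral_translate, ← nsmul_eq_mul, ← Finset.card_univ,
      ← Finset.card_erase_of_mem (Finset.mem_univ k₀), ← Finset.sum_const]
    refine Finset.sum_congr rfl fun i hi => integral_congr_ae ?_
    filter_upwards [coeFn_translateL2 hR (p.1.1 1), coeFn_translateL2 hR (q.1.1 1),
      coeFn_translateL2 hR (p.1.2 1), coeFn_translateL2 hR (q.1.2 1)] with x h1 h2 h3 h4
    simp only [edgeDensity, graft, graftPotential, if_neg (Finset.ne_of_mem_erase hi), h1, h2, h3,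
      h4]

theorem tendsto_integral_Ioi_zero {f : ℝ → ℂ} (hf : Integrable f halfLineMeasure) :
    Tendsto (fun n : ℕ => ∫ x in Ioi ((n : ℝ) + 1), f x) atTop (𝓝 0) := by
  have h := tendsto_setIntegral_of_antitone (f := f) (μ := volume)
    (s := fun n : ℕ => Ioi ((n : ℝ) + 1)) (fun _ => measurableSet_Ioi)
    (fun m n hmn => Ioi_subset_Ioi (by gcongr))
    ⟨0, IntegrableOn.mono_set hf (Ioi_subset_Ioi (by positivity))⟩
  have hempty : ⋂ n : ℕ, Ioi ((n : ℝ) + 1) = ∅ := by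
    rw [eq_empty_iff_forall_notMem]
    intro x hx
    obtain ⟨n, hn⟩ := exists_nat_ge x
    have := mem_iInter.1 hx n
    rw [mem_Ioi] at this
    linarith
  rwa [hempty, setIntegral_empty] at h

theorem tendsto_shiftedSesq_graft (k₀ : κ) {V : Fin 2 → ℝ → ℝ} {hV : IsPotential V} (lam : ℝ)
    (p q : domain hV) : Tendsto (fun n : ℕ => shiftedSesq (hV.graft k₀ (Nat.cast_add_one_pos n)) lam
      (graft k₀ (Nat.cast_add_one_pos n) p) (graft k₀ (Nat.cast_add_one_pos n) q)) atTop
      (𝓝 (shiftedSesq hV lam p q)) := by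
  have hint := integrable_edgeDensity lam p q 1
  have h1 := tendsto_integral_Ioi_zero hint
  have h2 : Tendsto (fun n : ℕ => ∫ x in Ioo 0 ((n : ℝ) + 1),
      edgeDensity (V 1) lam (p.1.1 1) (p.1.2 1) (q.1.1 1) (q.1.2 1) x) atTop
      (𝓝 (∫ x in Ioi (0 : ℝ),
        edgeDensity (V 1) lam (p.1.1 1) (p.1.2 1) (q.1.1 1) (q.1.2 1) x)) := by
    refine (intervalIntegral_tendsto_integral_Ioi 0 hint (b := fun n : ℕ => (n : ℝ) + 1)
      (tendsto_atTop_add_const_right _ _ tendsto_natCast_atTop_atTop)).congr fun n => ?_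
    rw [intervalIntegral.integral_of_le (by positivity), integral_Ioc_eq_integral_Ioo]
  simp only [shiftedSesq_graft]
  rw [shiftedSesq_eq_sum, Fin.sum_univ_two]
  have h3 := (tendsto_const_nhds (x := ∫ x in Ioi (0 : ℝ), edgeDensity (V 0) lam (p.1.1 0)
    (p.1.2 0) (q.1.1 0) (q.1.2 0) x)).add h2 |>.add
      (h1.const_mul ((Fintype.card κ - 1 : ℕ) : ℂ))
  rwa [mul_zero, add_zero] at h3

/-- Sesquilinear forms on `ℂᵏ` close to a negative definite diagonal form are negative definite. -/
theorem eventually_neg_of_tendsto {k : ℕ} {A : ℕ → Fin k → Fin k → ℂ} {d : Fin k → ℝ}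
    (hd : ∀ i, d i < 0)
    (hA : ∀ i j, Tendsto (fun n => A n i j) atTop (𝓝 (if i = j then (d i : ℂ) else 0))) :
    ∀ᶠ n in atTop, ∀ a : Fin k → ℂ, a ≠ 0 → (∑ i, ∑ j, conj (a i) * a j * A n i j).re < 0 := by
  obtain ⟨δ, hδ, hδd⟩ : ∃ δ > 0, ∀ i, d i ≤ -δ := by
    rcases isEmpty_or_nonempty (Fin k) with h | h
    · exact ⟨1, one_pos, fun i => h.elim i⟩
    · obtain ⟨i₀, hi₀⟩ := Finite.exists_max d
      exact ⟨-d i₀, by linarith [hd i₀], fun i => by simpa using hi₀ i⟩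
  -- By Cauchy–Schwarz, entries smaller than η perturb the form by at most ηk∑|aᵢ|², and ηk < δ.
  set η : ℝ := δ / (k + 1) with hη
  have hη0 : 0 < η := by positivity
  have hev : ∀ᶠ n in atTop, ∀ i j, ‖A n i j - (if i = j then (d i : ℂ) else 0)‖ < η := by
    rw [eventually_all]; intro i
    rw [eventually_all]; intro j
    have h := tendsto_iff_norm_sub_tendsto_zero.1 (hA i j)
    exact h.eventually_lt_const hη0
  filter_upwards [hev] with n hn a ha
  have hpos : 0 < ∑ i, ‖a i‖ ^ 2 := by
    obtain ⟨i, hi⟩ := Function.ne_iff.1 ha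
    refine Finset.sum_pos' (fun _ _ => sq_nonneg _) ⟨i, Finset.mem_univ i, ?_⟩
    have : 0 < ‖a i‖ := norm_pos_iff.2 hi
    positivity
  have hsplit : (∑ i, ∑ j, conj (a i) * a j * A n i j) = (∑ i, ((‖a i‖ ^ 2 * d i : ℝ) : ℂ)) +
      ∑ i, ∑ j, conj (a i) * a j * (A n i j - (if i = j then (d i : ℂ) else 0)) := by
    simp only [mul_sub, Finset.sum_sub_distrib, mul_ite, mul_zero, Finset.sum_ite_eq,
      Finset.mem_univ, if_true, Complex.conj_mul']
    push_cast
    ring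
  have h1 : (∑ i, ((‖a i‖ ^ 2 * d i : ℝ) : ℂ)).re ≤ -δ * ∑ i, ‖a i‖ ^ 2 := by
    rw [Complex.re_sum, Finset.mul_sum]
    refine Finset.sum_le_sum fun i _ => ?_
    rw [Complex.ofReal_re]
    nlinarith [hδd i, sq_nonneg ‖a i‖]
  have h2 : (∑ i, ∑ j, conj (a i) * a j * (A n i j - (if i = j then (d i : ℂ) else 0))).re ≤
      η * (k * ∑ i, ‖a i‖ ^ 2) := by
    calc _ ≤ ‖∑ i, ∑ j, conj (a i) * a j * (A n i j - (if i = j then (d i : ℂ) else 0))‖ :=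
          Complex.re_le_norm _
      _ ≤ ∑ i, ∑ j, ‖a i‖ * ‖a j‖ * η := by
          refine norm_sum_le_of_le _ fun i _ => norm_sum_le_of_le _ fun j _ => ?_
          rw [norm_mul, norm_mul, RCLike.norm_conj]
          exact mul_le_mul_of_nonneg_left (hn i j).le (by positivity)
      _ = η * (∑ i, ‖a i‖) ^ 2 := by
          rw [sq, Finset.sum_mul_sum, Finset.mul_sum]
          refine Finset.sum_congr rfl fun i _ => ?_
          rw [Finset.mul_sum]
          exact Finset.sum_congr rfl fun j _ => by ring
      _ ≤ _ := by
          refine mul_le_mul_of_nonneg_left ?_ hη0.le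
          have := sq_sum_le_card_mul_sum_sq (s := Finset.univ) (f := fun i => ‖a i‖)
          simpa using this
  have h3 : η * k < δ := by
    rw [hη, div_mul_eq_mul_div, div_lt_iff₀ (by positivity)]
    nlinarith
  rw [hsplit, Complex.add_re]
  nlinarith

/-- The two-graph principle with a second graph that has no edges. -/
theorem le_count {ι : Type} [Fintype ι] {V : ι → ℝ → ℝ} (hV : IsPotential V) {E : ℝ} (hE : E < 0)
    {k : ℕ} (f : Fin k → domain hV)
    (hneg : ∀ a : Fin k → ℂ, a ≠ 0 → shiftedForm hV E (∑ i, a i • f i) < 0) :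
    (k : ℝ≥0∞) ≤ count V E := by
  have hV₀ : IsPotential (fun (_ : Fin 0) (_ : ℝ) => (0 : ℝ)) :=
    ⟨fun i => i.elim0, ⟨1, le_rfl, ENNReal.one_ne_top, fun i => i.elim0⟩⟩
  have h := le_count_add_count hV hV₀ hE f (fun _ => 0) fun a ha => by
    rw [shiftedForm_eq_sum (hV := hV₀), Fin.sum_univ_zero, add_zero]
    exact hneg a ha
  rwa [count_eq_zero_of_nonneg hV₀ (fun i => i.elim0) hE, add_zero] at h

/-- The transplanted eigenfunctions need not be orthonormal: the matrix of H - E on them tends to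
the diagonal matrix with entries μᵢ - E < 0, hence is eventually negative definite. -/
theorem count_le_liminf_graft (k₀ : κ) {V : Fin 2 → ℝ → ℝ} (hV : IsPotential V) {E : ℝ}
    (hE : E < 0) :
    count V E ≤ liminf (fun n : ℕ => count (graftPotential k₀ ((n : ℝ) + 1) V) E) atTop := by
  refine le_of_forall_natCast_le_tsum _ fun k hk => ?_
  obtain ⟨f, mu, hmuE, hon, hmu⟩ := exists_orthonormal_of_le_count hV hk
  refine le_liminf_of_le (by isBoundedDefault) ?_
  have hev := eventually_neg_of_tendsto (k := k)
    (A := fun n i j => shiftedSesq (hV.graft k₀ (Nat.cast_add_one_pos n)) E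
      (graft k₀ (Nat.cast_add_one_pos n) (f i)) (graft k₀ (Nat.cast_add_one_pos n) (f j)))
    (d := fun i => mu i - E) (fun i => by linarith [hmuE i]) (fun i j => by
      rw [← shiftedSesq_of_eigen hon hmu]
      exact tendsto_shiftedSesq_graft k₀ E (f i) (f j))
  filter_upwards [hev] with n hn
  refine le_count (hV.graft k₀ (Nat.cast_add_one_pos n)) hE
    (fun i => graft k₀ (Nat.cast_add_one_pos n) (f i)) fun a ha => ?_
  rw [shiftedForm_sum_smul]
  exact hn a ha

theorem negIntegral_graft_le (k₀ : κ) {R : ℝ} (hR : 0 < R) (V : Fin 2 → ℝ → ℝ) (γ : ℝ) :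
    negIntegral γ (graftPotential k₀ R V) ≤ negIntegral γ V +
      Fintype.card κ * ∫⁻ x in Ioi R, ENNReal.ofReal ((V 1 x)⁻ ^ (γ + 1 / 2)) := by
  have h1 : ∫⁻ x in Ioi (0 : ℝ), ENNReal.ofReal ((graftPotential k₀ R V k₀ x)⁻ ^ (γ + 1 / 2)) ≤
      negIntegral γ V := by
    simp only [graftPotential, if_true,
      glue_comp fun y : ℝ => ENNReal.ofReal (y⁻ ^ (γ + 1 / 2))]
    rw [lintegral_glue hR, negIntegral, Fin.sum_univ_two]
    exact add_le_add le_rfl (lintegral_mono_set Ioo_subset_Ioi_self)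
  have h2 : ∀ i ∈ Finset.univ.erase k₀, ∫⁻ x in Ioi (0 : ℝ),
      ENNReal.ofReal ((graftPotential k₀ R V i x)⁻ ^ (γ + 1 / 2)) =
      ∫⁻ x in Ioi R, ENNReal.ofReal ((V 1 x)⁻ ^ (γ + 1 / 2)) := by
    intro i hi
    simp only [graftPotential, if_neg (Finset.ne_of_mem_erase hi)]
    exact lintegral_translate R fun x => ENNReal.ofReal ((V 1 x)⁻ ^ (γ + 1 / 2))
  rw [negIntegral, ← Finset.add_sum_erase _ _ (Finset.mem_univ k₀), Finset.sum_congr rfl h2,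
    Finset.sum_const, nsmul_eq_mul]
  refine add_le_add h1 (mul_le_mul_left (Nat.cast_le.2 ?_) _)
  exact (Finset.card_le_univ _)

theorem tendsto_lintegral_Ioi_zero {f : ℝ → ℝ≥0∞} (hf : ∫⁻ x in Ioi (0 : ℝ), f x ≠ ∞) :
    Tendsto (fun n : ℕ => ∫⁻ x in Ioi ((n : ℝ) + 1), f x) atTop (𝓝 0) := by
  have h := tendsto_measure_iInter_atTop (μ := (volume : Measure ℝ).withDensity f)
    (s := fun n : ℕ => Ioi ((n : ℝ) + 1)) (fun _ => measurableSet_Ioi.nullMeasurableSet)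
    (fun m n hmn => Ioi_subset_Ioi (by gcongr)) ⟨0, by
      rw [withDensity_apply _ measurableSet_Ioi]
      exact ne_top_of_le_ne_top hf (lintegral_mono_set (Ioi_subset_Ioi (by positivity)))⟩
  have hempty : ⋂ n : ℕ, Ioi ((n : ℝ) + 1) = ∅ := by
    rw [eq_empty_iff_forall_notMem]
    intro x hx
    obtain ⟨n, hn⟩ := exists_nat_ge x
    have := mem_iInter.1 hx n
    rw [mem_Ioi] at this
    linarith
  rw [hempty, measure_empty] at h
  exact h.congr fun n => withDensity_apply _ measurableSet_Ioi

theorem lineConst_le_optConst {γ : ℝ} (hγ : 0 < γ) {N : ℕ} (hN : N ≠ 0) :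
    lineConst γ ≤ optConst γ N := by
  refine sInf_le fun V hV hI => ?_
  -- Multiplication by a possibly infinite constant is continuous only away from 0, so this case is
  -- removed before passing to the limit.
  by_cases h0 : negIntegral γ V = 0
  · rw [traceNeg_eq_zero hV hγ h0]; exact zero_le
  have : NeZero N := ⟨hN⟩
  set W : ℕ → Fin N → ℝ → ℝ := fun n => graftPotential 0 ((n : ℝ) + 1) V with hW
  have hVI : ∫⁻ x in Ioi (0 : ℝ), ENNReal.ofReal ((V 1 x)⁻ ^ (γ + 1 / 2)) ≠ ∞ :=
    ENNReal.sum_ne_top.1 hI 1 (Finset.mem_univ _)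
  have htail := tendsto_lintegral_Ioi_zero hVI
  have hle : ∀ n, negIntegral γ (W n) ≤ negIntegral γ V + N *
      ∫⁻ x in Ioi ((n : ℝ) + 1), ENNReal.ofReal ((V 1 x)⁻ ^ (γ + 1 / 2)) := fun n => by
    have := negIntegral_graft_le (0 : Fin N) (Nat.cast_add_one_pos n) V γ
    rwa [Fintype.card_fin] at this
  have hlim : Tendsto (fun n : ℕ => optConst γ N * (negIntegral γ V + N *
      ∫⁻ x in Ioi ((n : ℝ) + 1), ENNReal.ofReal ((V 1 x)⁻ ^ (γ + 1 / 2)))) atTop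
      (𝓝 (optConst γ N * negIntegral γ V)) := by
    have h1 : Tendsto (fun n : ℕ => negIntegral γ V + N *
        ∫⁻ x in Ioi ((n : ℝ) + 1), ENNReal.ofReal ((V 1 x)⁻ ^ (γ + 1 / 2))) atTop
        (𝓝 (negIntegral γ V)) := by
      have h2 := (ENNReal.Tendsto.const_mul (a := (N : ℝ≥0∞)) htail
        (Or.inr (ENNReal.natCast_ne_top N))).const_add (negIntegral γ V)
      rwa [mul_zero, add_zero] at h2
    exact ENNReal.Tendsto.const_mul h1 (Or.inl h0)
  have hfin : ∀ n, negIntegral γ (W n) ≠ ∞ := fun n =>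
    ne_top_of_le_ne_top (ENNReal.add_ne_top.2 ⟨hI, ENNReal.mul_ne_top (ENNReal.natCast_ne_top N)
      (ne_top_of_le_ne_top hVI (lintegral_mono_set (Ioi_subset_Ioi (by positivity))))⟩) (hle n)
  have htr : ∀ n, traceNeg γ (W n) ≤ optConst γ N * (negIntegral γ V + N *
      ∫⁻ x in Ioi ((n : ℝ) + 1), ENNReal.ofReal ((V 1 x)⁻ ^ (γ + 1 / 2))) := fun n =>
    (traceNeg_le_optConst_mul hγ (hV.graft 0 (Nat.cast_add_one_pos n)) (hfin n)).trans
      (mul_le_mul_right (hle n) _)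
  calc traceNeg γ V = ∫⁻ s in Ioi (0 : ℝ), count V (-s ^ (1 / γ)) := traceNeg_eq_lintegral hγ V
    _ ≤ ∫⁻ s in Ioi (0 : ℝ), liminf (fun n => count (W n) (-s ^ (1 / γ))) atTop :=
        setLIntegral_mono' measurableSet_Ioi fun s hs =>
          count_le_liminf_graft 0 hV (neg_lt_zero.2 (Real.rpow_pos_of_pos hs _))
    _ ≤ liminf (fun n => ∫⁻ s in Ioi (0 : ℝ), count (W n) (-s ^ (1 / γ))) atTop :=
        lintegral_liminf_le fun n => measurable_count_neg_rpow _ _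
    _ = liminf (fun n => traceNeg γ (W n)) atTop := by simp only [traceNeg_eq_lintegral hγ]
    _ ≤ liminf (fun n : ℕ => optConst γ N * (negIntegral γ V + N *
      ∫⁻ x in Ioi ((n : ℝ) + 1), ENNReal.ofReal ((V 1 x)⁻ ^ (γ + 1 / 2)))) atTop :=
        liminf_le_liminf (Eventually.of_forall htr)
    _ = optConst γ N * negIntegral γ V := hlim.liminf_eq

theorem optConst_eq_lineConst {γ : ℝ} (hγ : 0 < γ) {N₀ N : ℕ} (h₀ : Odd N₀)
    (h : optConst γ N₀ = lineConst γ) (hN : N₀ ≤ N) : optConst γ N = lineConst γ := by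
  have hpos : N ≠ 0 := by
    have := h₀.pos
    omega
  refine le_antisymm ?_ (lineConst_le_optConst hγ hpos)
  rcases Nat.even_or_odd N with hev | hodd
  · obtain ⟨m, rfl⟩ := hev
    rw [← two_mul]
    exact optConst_two_mul_le hγ m
  · rcases hN.eq_or_lt with rfl | hlt
    · exact h.le
    · refine (optConst_le_convex_combination hγ h₀ hodd hlt).trans (le_of_eq ?_)
      have hN0 : (0 : ℝ) < N := by positivity
      have hlt' : (N₀ : ℝ) < N := by exact_mod_cast hlt
      rw [h, ← add_mul, ← ENNReal.ofReal_add (div_nonneg (by linarith) hN0.le) (by positivity),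
        ← add_div, sub_add_cancel, div_self hN0.ne', ENNReal.ofReal_one, one_mul]

end

end StarGraph

end

theorem mainTheorem3 (γ : ℝ) (hγ : 1 / 2 ≤ γ) :
    (∀ N₀ N : ℕ, Odd N₀ → Odd N → N₀ < N →
      StarGraph.optConst γ N ≤
        ENNReal.ofReal (((N : ℝ) - (N₀ : ℝ)) / (N : ℝ)) * StarGraph.lineConst γ +
          ENNReal.ofReal ((N₀ : ℝ) / (N : ℝ)) * StarGraph.optConst γ N₀) ∧
    (∀ N₀ : ℕ, Odd N₀ → StarGraph.optConst γ N₀ = StarGraph.lineConst γ →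
      ∀ N : ℕ, N₀ ≤ N → StarGraph.optConst γ N = StarGraph.lineConst γ) :=
  ⟨fun _ _ h₀ h hlt => StarGraph.optConst_le_convex_combination (by linarith) h₀ h hlt,
    fun _ h₀ h _ hN => StarGraph.optConst_eq_lineConst (by linarith) h₀ h hN⟩
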